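/- All Hilbert spaces are finite-dimensional and complex, and $\log$ is the logarithm to base $2$. A sub-normalized state on $\mathcal H$ is a positive semidefinite operator $\rho$ with $\operatorname{tr}\rho\le 1$; write $\mathcal S_\le(\mathcal H)$ for the set of these. For positive semidefinite $\rho,\sigma$ let $F(\rho,\sigma)=\|\sqrt\rho\sqrt\sigma\|_1$, where $\|X\|_1=\operatorname{tr}\sqrt{X^\dagger X}$. For $\rho,\sigma\in\mathcal S_\le(\mathcal H)$ let $$P(\rho,\sigma)=\sqrt{1-\Bigl(F(\rho,\sigma)+\sqrt{(1-\operatorname{tr}\rho)(1-\operatorname{tr}\sigma)}\Bigr)^2}$$ be the purified distance. For $\rho_{AB}\in\mathcal S_\le(\mathcal H_A\otimes\mathcal H_B)$ define, with values in $[-\infty,\infty]$ (where $\log 0=-\infty$ and $\sup\emptyset=-\infty$), $$H_{\min}(A|B)_\rho=\sup_{\sigma_B\in\mathcal S_\le(\mathcal H_B)}\sup\{\lambda\in\mathbb R:\rho_{AB}\le 2^{-\lambda}\,1_A\otimes\sigma_B\},\qquad H_{\max}(A|B)_\rho=\sup_{\sigma_B\in\mathcal S_\le(\mathcal H_B)}\log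 F(\rho_{AB},1_A\otimes\sigma_B)^2,$$ and, for $\varepsilon\ge 0$, $$H_{\min}^{\varepsilon}(A|B)_\rho=\sup_{\tilde\rho}H_{\min}(A|B)_{\tilde\rho},\qquad H_{\max}^{\varepsilon}(A|B)_\rho=\inf_{\tilde\rho}H_{\max}(A|B)_{\tilde\rho},$$ where $\tilde\rho$ ranges over all $\tilde\rho_{AB}\in\mathcal S_\le(\mathcal H_A\otimes\mathcal H_B)$ with $P(\tilde\rho,\rho)\le\varepsilon$. Let $$f(\varepsilon)=\log\frac{1}{1-\sqrt{1-\varepsilon^2}}\quad(0<\varepsilon\le 1),\qquad f(\varepsilon)=0\quad(\varepsilon>1).$$ **Theorem.** Let $\varepsilon>0$, $\varepsilon',\varepsilon''\ge 0$, and let $\rho_{ABC}$ be a sub-normalized state on $\mathcal H_A\otimes\mathcal H_B\otimes\mathcal H_C$ with $\varepsilon''<\sqrt{\operatorname{tr}\rho_{ABC}}$. Then $$H_{\min}^{\varepsilon'}(AB|C)_\rho\le H_{\max}^{\varepsilon''}(A|BC)_\rho+H_{\min}^{2\varepsilon+\varepsilon'+2\varepsilon''}(B|C)_\rho+3f(\varepsilon),$$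 where $H_{\min}(B|C)_\rho$ refers to the reduced state $\rho_{BC}=\operatorname{tr}_A\rho_{ABC}$. -/

import Mathlib

open scoped Matrix Kronecker MatrixOrder ComplexOrder

noncomputable section

namespace SmoothEntropy

/-- `IsSubState ρ`: the operator `ρ` on the Hilbert space `ℂ^n` is a sub-normalized state,
i.e. it is positive semidefinite and `tr ρ ≤ 1`. -/
def IsSubState {n : Type*} [Fintype n] (ρ : Matrix n n ℂ) : Prop :=
  ρ.PosSemidef ∧ ρ.trace.re ≤ 1

/-- Partial trace over the first tensor factor. -/
def traceFst {a b : Type*} [Fintype a] (X : Matrix (a × b) (a × b) ℂ) : Matrix b b ℂ :=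
  Matrix.of fun i j => ∑ k, X (k, i) (k, j)

/-- The trace norm `‖X‖₁ = tr √(X† X)`. -/
def traceNorm {n : Type*} [Fintype n] [DecidableEq n] (X : Matrix n n ℂ) : ℝ :=
  (CFC.sqrt (Xᴴ * X)).trace.re

/-- The fidelity `F(ρ, σ) = ‖√ρ √σ‖₁`. -/
def fidelity {n : Type*} [Fintype n] [DecidableEq n] (ρ σ : Matrix n n ℂ) : ℝ :=
  traceNorm (CFC.sqrt ρ * CFC.sqrt σ)

/-- The generalized fidelity of two sub-normalized states. -/
def genFidelity {n : Type*} [Fintype n] [DecidableEq n] (ρ σ : Matrix n n ℂ) : ℝ :=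
  fidelity ρ σ + Real.sqrt ((1 - ρ.trace.re) * (1 - σ.trace.re))

/-- The purified distance of two sub-normalized states. -/
def purifiedDist {n : Type*} [Fintype n] [DecidableEq n] (ρ σ : Matrix n n ℂ) : ℝ :=
  Real.sqrt (1 - genFidelity ρ σ ^ 2)

/-- The set of sub-normalized states that are `ε`-close to `ρ` in purified distance. -/
def closeStates {n : Type*} [Fintype n] [DecidableEq n] (ε : ℝ) (ρ : Matrix n n ℂ) :
    Set (Matrix n n ℂ) :=
  {ρ' | IsSubState ρ' ∧ purifiedDist ρ' ρ ≤ ε}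

/-- The logarithm to base `2` of a nonnegative real, with `log 0 = -∞`. -/
def elog2 (x : ℝ) : EReal :=
  if x ≤ 0 then ⊥ else ((Real.logb 2 x : ℝ) : EReal)

/-- `H_min(A|B)_{ρ|σ}`: the supremum in `[-∞, ∞]` of all real `l` with
`ρ_AB ≤ 2^{-l} 1_A ⊗ σ_B`. -/
def hMinRel {a b : Type*} [Fintype a] [DecidableEq a] [Fintype b] [DecidableEq b]
    (ρ : Matrix (a × b) (a × b) ℂ) (σ : Matrix b b ℂ) : EReal :=
  ⨆ (l : ℝ) (_ : ρ ≤ ((2 : ℝ) ^ (-l)) • ((1 : Matrix a a ℂ) ⊗ₖ σ)), (l : EReal)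

/-- The conditional min-entropy `H_min(A|B)_ρ`. -/
def hMin {a b : Type*} [Fintype a] [DecidableEq a] [Fintype b] [DecidableEq b]
    (ρ : Matrix (a × b) (a × b) ℂ) : EReal :=
  ⨆ (σ : Matrix b b ℂ) (_ : IsSubState σ), hMinRel ρ σ

/-- `H_max(A|B)_{ρ|σ} = log F(ρ_AB, 1_A ⊗ σ_B)²`. -/
def hMaxRel {a b : Type*} [Fintype a] [DecidableEq a] [Fintype b] [DecidableEq b]
    (ρ : Matrix (a × b) (a × b) ℂ) (σ : Matrix b b ℂ) : EReal :=
  elog2 (fidelity ρ ((1 : Matrix a a ℂ) ⊗ₖ σ) ^ 2)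

/-- The conditional max-entropy `H_max(A|B)_ρ`. -/
def hMax {a b : Type*} [Fintype a] [DecidableEq a] [Fintype b] [DecidableEq b]
    (ρ : Matrix (a × b) (a × b) ℂ) : EReal :=
  ⨆ (σ : Matrix b b ℂ) (_ : IsSubState σ), hMaxRel ρ σ

/-- The `ε`-smooth conditional min-entropy `H_min^ε(A|B)_ρ`. -/
def smoothHMin {a b : Type*} [Fintype a] [DecidableEq a] [Fintype b] [DecidableEq b]
    (ε : ℝ) (ρ : Matrix (a × b) (a × b) ℂ) : EReal :=
  ⨆ ρ' ∈ closeStates ε ρ, hMin ρ'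

/-- The `ε`-smooth conditional max-entropy `H_max^ε(A|B)_ρ`. -/
def smoothHMax {a b : Type*} [Fintype a] [DecidableEq a] [Fintype b] [DecidableEq b]
    (ε : ℝ) (ρ : Matrix (a × b) (a × b) ℂ) : EReal :=
  ⨅ ρ' ∈ closeStates ε ρ, hMax ρ'

/-- An operator on `A ⊗ (B ⊗ C)` regarded as an operator on `(A ⊗ B) ⊗ C`. -/
def assocLeft {a b c : Type*} (ρ : Matrix (a × b × c) (a × b × c) ℂ) :
    Matrix ((a × b) × c) ((a × b) × c) ℂ :=
  ρ.submatrix (Equiv.prodAssoc a b c) (Equiv.prodAssoc a b c)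

/-- The error term `f(ε) = log₂ (1 / (1 - √(1 - ε²)))`. For `ε > 1` the value is `0`, because
`Real.sqrt` vanishes on negative numbers. -/
def errorTerm (ε : ℝ) : ℝ :=
  Real.logb 2 (1 / (1 - Real.sqrt (1 - ε ^ 2)))

end SmoothEntropy

end

/-! The argument works with purifications, written as matrices `R` with `R * Rᴴ = ρ` whose column
index is a purifying system D. By Uhlmann's theorem (`exists_purification`), states near `ρ` in
purified distance have purifications equally near that of `ρ`, so everything reduces to vectors in
Hilbert-Schmidt space, where a projection on the column side acts on the complementary system.

Let `R₁` purify a state with large min-entropy of AB given C, and `R₂` one with small max-entropy of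
A given BC. An operator bound `R₁ * R₁ᴴ ≤ r • 1 ⊗ σ` gives a projection `P` on ABD that removes
weight at most `δ = 1 - √(1 - ε²)` from `R₁` and whose partial trace on D is at most `r / δ`
(`exists_projection_of_le`). The spectral projection `E` of `tr_B P` on AD above a threshold `s`
then has partial trace at most `r / (δ s)` on D. The max-entropy bound `M` for `R₂` limits the
weight of `R₂` on `E` to `M r / (δ s)` (`norm_foldFst_mul_proj_sq_le`), which equals `δ` for `s = M
r / δ²`.

Applying `P` and then `1 - E` to `R₁` leaves a vector whose BC marginal is at most `s • 1 ⊗ ω`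
(`unfoldFst_proj_mul_le`). It stays close to `R`: `1 - E` barely disturbs `R₂`, hence also vectors
near it (`vecDist_mul_proj_self_le_add`). Taking logarithms, `s` costs `2 f(ε)`, which is within the
allowed `3 f(ε)` because `f ≥ 0`. -/

open scoped Matrix Kronecker MatrixOrder ComplexOrder

noncomputable section

namespace SmoothEntropy

/-! ### Purified distance for vectors of norm at most one -/

section PureVectors

variable {E : Type*} [NormedAddCommGroup E] [InnerProductSpace ℂ E]

/-- The generalized fidelity of two vectors of norm at most one. -/
def vecFidelity (u v : E) : ℝ :=
  ‖inner ℂ u v‖ + √((1 - ‖u‖ ^ 2) * (1 - ‖v‖ ^ 2))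

/-- The purified distance of two vectors of norm at most one. -/
def vecDist (u v : E) : ℝ :=
  √(1 - vecFidelity u v ^ 2)

lemma vecFidelity_nonneg (u v : E) : 0 ≤ vecFidelity u v := by
  unfold vecFidelity; positivity

lemma vecFidelity_comm (u v : E) : vecFidelity u v = vecFidelity v u := by
  unfold vecFidelity
  rw [norm_inner_symm, mul_comm]

lemma vecDist_comm (u v : E) : vecDist u v = vecDist v u := by
  rw [vecDist, vecFidelity_comm, vecDist]

lemma vecDist_le_vecDist {F : Type*} [NormedAddCommGroup F] [InnerProductSpace ℂ F]
    {u v : E} {u' v' : F} (h : vecFidelity u v ≤ vecFidelity u' v') :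
    vecDist u' v' ≤ vecDist u v := by
  have := vecFidelity_nonneg u v
  exact Real.sqrt_le_sqrt (by gcongr)

/-- This is the triangle inequality for angles, cos(α + β) ≤ cos γ. It follows from Cauchy-Schwarz
for the components of `x` and `z` orthogonal to `y`. -/
lemma norm_inner_mul_sub_le {x y z : E} (hx : ‖x‖ = 1) (hy : ‖y‖ = 1) (hz : ‖z‖ = 1) :
    ‖inner ℂ x y‖ * ‖inner ℂ y z‖ - √(1 - ‖inner ℂ x y‖ ^ 2) * √(1 - ‖inner ℂ y z‖ ^ 2)
      ≤ ‖inner ℂ x z‖ := by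
  have hyy : inner ℂ y y = 1 := by simp [inner_self_eq_norm_sq_to_K, hy]
  have key : ∀ p q : E, inner ℂ (p - inner ℂ y p • y) (q - inner ℂ y q • y)
      = inner ℂ p q - inner ℂ p y * inner ℂ y q := by
    intro p q
    simp only [inner_sub_left, inner_sub_right, inner_smul_left, inner_smul_right, hyy,
      inner_conj_symm]
    ring
  have hn : ∀ p : E, ‖p‖ = 1 → ‖p - inner ℂ y p • y‖ = √(1 - ‖inner ℂ y p‖ ^ 2) := by
    intro p hp
    have h := key p p
    rw [inner_self_eq_norm_sq_to_K, inner_self_eq_norm_sq_to_K, hp, ← inner_conj_symm p y,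
      Complex.conj_mul'] at h
    have h' : ‖p - inner ℂ y p • y‖ ^ 2 = 1 - ‖inner ℂ y p‖ ^ 2 := by
      apply Complex.ofReal_injective
      simpa using h
    rw [← h', Real.sqrt_sq (norm_nonneg _)]
  have hcs := norm_inner_le_norm (𝕜 := ℂ) (x - inner ℂ y x • y) (z - inner ℂ y z • y)
  rw [key, hn x hx, hn z hz, norm_inner_symm y x] at hcs
  have htri : ‖inner ℂ x y * inner ℂ y z‖ ≤ ‖inner ℂ x z‖
      + ‖inner ℂ x z - inner ℂ x y * inner ℂ y z‖ := norm_le_insert _ _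
  rw [norm_mul] at htri
  linarith

/-- A vector of norm at most one, completed to a unit vector. -/
def completeVec (u : E) : WithLp 2 (E × ℂ) :=
  WithLp.toLp 2 (u, ((√(1 - ‖u‖ ^ 2) : ℝ) : ℂ))

lemma inner_completeVec (u v : E) : inner ℂ (completeVec u) (completeVec v)
    = inner ℂ u v + ((√(1 - ‖u‖ ^ 2) * √(1 - ‖v‖ ^ 2) : ℝ) : ℂ) := by
  simp [completeVec, mul_comm]

lemma norm_completeVec {u : E} (hu : ‖u‖ ≤ 1) : ‖completeVec u‖ = 1 := by
  have h := inner_completeVec u u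
  have h1 : 0 ≤ 1 - ‖u‖ ^ 2 := by nlinarith [norm_nonneg u]
  rw [inner_self_eq_norm_sq_to_K, inner_self_eq_norm_sq_to_K, Real.mul_self_sqrt h1] at h
  have h2 : ‖completeVec u‖ ^ 2 = 1 := by
    apply Complex.ofReal_injective
    rw [Complex.ofReal_pow, Complex.ofReal_one]
    exact h.trans (by simp)
  exact (pow_eq_one_iff_of_nonneg (norm_nonneg _) two_ne_zero).1 h2

lemma norm_inner_completeVec_le {u v : E} (hu : ‖u‖ ≤ 1) :
    ‖inner ℂ (completeVec u) (completeVec v)‖ ≤ vecFidelity u v := by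
  have h1 : 0 ≤ 1 - ‖u‖ ^ 2 := by nlinarith [norm_nonneg u]
  rw [inner_completeVec, vecFidelity, Real.sqrt_mul h1]
  refine (norm_add_le _ _).trans (le_of_eq ?_)
  rw [Complex.norm_real, Real.norm_of_nonneg (by positivity)]

/-- Rotating the phase of `u` makes its overlap with `v` nonnegative, so the two summands of the
completed inner product add without cancellation. -/
lemma exists_norm_inner_completeVec_eq {u : E} (v : E) (hu : ‖u‖ ≤ 1) :
    ∃ z : ℂ, ‖z‖ = 1 ∧ ‖inner ℂ (completeVec (z • u)) (completeVec v)‖ = vecFidelity u v := by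
  obtain ⟨z, hz, hz'⟩ := RCLike.exists_norm_eq_mul_self (inner ℂ u v)
  refine ⟨(starRingEnd ℂ) z, by simpa using hz, ?_⟩
  have h1 : 0 ≤ 1 - ‖u‖ ^ 2 := by nlinarith [norm_nonneg u]
  have hz'' : z * inner ℂ u v = ((‖inner ℂ u v‖ : ℝ) : ℂ) := hz'.symm
  rw [inner_completeVec, inner_smul_left, Complex.conj_conj, hz'', norm_smul, RCLike.norm_conj, hz,
    one_mul, vecFidelity, Real.sqrt_mul h1, ← Complex.ofReal_add, Complex.norm_real,
    Real.norm_of_nonneg (by positivity)]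

lemma vecFidelity_smul_smul {z z' : ℂ} (hz : ‖z‖ = 1) (hz' : ‖z'‖ = 1) (u v : E) :
    vecFidelity (z • u) (z' • v) = vecFidelity u v := by
  simp [vecFidelity, norm_smul, hz, hz']

lemma vecDist_triangle {u v w : E} (hu : ‖u‖ ≤ 1) (hv : ‖v‖ ≤ 1) (hw : ‖w‖ ≤ 1) :
    vecDist u w ≤ vecDist u v + vecDist v w := by
  obtain ⟨z, hz, hzu⟩ := exists_norm_inner_completeVec_eq v hu
  obtain ⟨y, hy, hyw⟩ := exists_norm_inner_completeVec_eq v hw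
  have hzu1 : ‖z • u‖ ≤ 1 := by rwa [norm_smul, hz, one_mul]
  have hyw1 : ‖y • w‖ ≤ 1 := by rwa [norm_smul, hy, one_mul]
  have hxu := norm_completeVec hzu1
  have hxv := norm_completeVec hv
  have hxw := norm_completeVec hyw1
  have hle := norm_inner_completeVec_le (v := y • w) hzu1
  rw [vecFidelity_smul_smul hz hy] at hle
  have hg := norm_inner_mul_sub_le hxu hxv hxw
  rw [norm_inner_symm (completeVec v), hzu, hyw, vecFidelity_comm w v] at hg
  have ha1 : vecFidelity u v ≤ 1 := by
    rw [← hzu]; simpa [hxu, hxv] using norm_inner_le_norm (𝕜 := ℂ) (completeVec (z • u))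
      (completeVec v)
  have hb1 : vecFidelity v w ≤ 1 := by
    rw [vecFidelity_comm, ← hyw]
    simpa [hxw, hxv] using norm_inner_le_norm (𝕜 := ℂ) (completeVec (y • w)) (completeVec v)
  have ha0 := vecFidelity_nonneg u v
  have hb0 := vecFidelity_nonneg v w
  have hc := hg.trans hle
  unfold vecDist
  set a := vecFidelity u v
  set b := vecFidelity v w
  set c := vecFidelity u w
  have hs := Real.sq_sqrt (show 0 ≤ 1 - a ^ 2 by nlinarith)
  have ht := Real.sq_sqrt (show 0 ≤ 1 - b ^ 2 by nlinarith)
  have hs0 := Real.sqrt_nonneg (1 - a ^ 2)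
  have ht0 := Real.sqrt_nonneg (1 - b ^ 2)
  set s := √(1 - a ^ 2)
  set t := √(1 - b ^ 2)
  refine Real.sqrt_le_iff.2 ⟨by positivity, ?_⟩
  rcases le_total (s * t) (a * b) with h | h
  -- With `a`, `b` cosines and `s`, `t` sines, this case uses sin(α + β) = a t + b s ≤ s + t. In the
  -- other case α + β is at least a right angle, and already s² + t² ≥ 1.
  · have hc2 : (a * b - s * t) ^ 2 ≤ c ^ 2 := by
      apply pow_le_pow_left₀ <;> linarith
    have e1 : 1 - (a * b - s * t) ^ 2 = (a * t + b * s) ^ 2 := by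
      have ha : a ^ 2 = 1 - s ^ 2 := by linarith
      have hb : b ^ 2 = 1 - t ^ 2 := by linarith
      have e2 : (a * b - s * t) ^ 2 + (a * t + b * s) ^ 2 = (a ^ 2 + s ^ 2) * (b ^ 2 + t ^ 2) := by
        ring
      rw [ha, hb] at e2
      linarith
    have e3 : a * t + b * s ≤ s + t := by nlinarith
    have e4 : (a * t + b * s) ^ 2 ≤ (s + t) ^ 2 := by gcongr
    linarith
  · have h2 : (a * b) ^ 2 ≤ (s * t) ^ 2 := by gcongr
    have h3 : a ^ 2 * b ^ 2 ≤ s ^ 2 * t ^ 2 := by linarith [mul_pow a b 2, mul_pow s t 2]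
    rw [hs, ht] at h3
    have : 0 ≤ s * t := by positivity
    have : 0 ≤ c ^ 2 := by positivity
    nlinarith

lemma norm_sq_eq_of_inner_eq_zero {u u' : E} (h : inner ℂ u' (u - u') = 0) :
    ‖u‖ ^ 2 = ‖u'‖ ^ 2 + ‖u - u'‖ ^ 2 := by
  have := norm_add_sq_eq_norm_sq_add_norm_sq_of_inner_eq_zero (𝕜 := ℂ) u' (u - u') h
  rw [add_sub_cancel] at this
  simpa [sq] using this

lemma norm_le_of_inner_eq_zero {u u' : E} (h : inner ℂ u' (u - u') = 0) : ‖u'‖ ≤ ‖u‖ := by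
  have := norm_sq_eq_of_inner_eq_zero h
  exact (sq_le_sq₀ (norm_nonneg _) (norm_nonneg _)).1 (by nlinarith [sq_nonneg ‖u - u'‖])

/-- The overlap lost with the discarded components is at most the product of their norms, and the
growth of the trace-deficit term compensates for it, again by Cauchy-Schwarz. -/
lemma vecDist_proj_le {u u' v v' : E} (hu : ‖u‖ ≤ 1) (hv : ‖v‖ ≤ 1)
    (huu : inner ℂ u' (u - u') = 0) (hvv : inner ℂ v' (v - v') = 0)
    (huv : inner ℂ u' (v - v') = 0) (hvu : inner ℂ v' (u - u') = 0) :
    vecDist u' v' ≤ vecDist u v := by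
  apply vecDist_le_vecDist
  have h1 := norm_sq_eq_of_inner_eq_zero huu
  have h2 := norm_sq_eq_of_inner_eq_zero hvv
  have h3 : inner ℂ u v = inner ℂ u' v' + inner ℂ (u - u') (v - v') := by
    have h4 : inner ℂ (u - u') v' = 0 := inner_eq_zero_symm.1 hvu
    calc inner ℂ u v = inner ℂ (u' + (u - u')) (v' + (v - v')) := by simp
      _ = _ := by rw [inner_add_left, inner_add_right, inner_add_right, huv, h4]; ring
  have h5 : ‖inner ℂ u v‖ ≤ ‖inner ℂ u' v'‖ + ‖u - u'‖ * ‖v - v'‖ := by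
    rw [h3]
    exact (norm_add_le _ _).trans (add_le_add le_rfl (norm_inner_le_norm _ _))
  have hu1 : 0 ≤ 1 - ‖u‖ ^ 2 := by nlinarith [norm_nonneg u]
  have hv1 : 0 ≤ 1 - ‖v‖ ^ 2 := by nlinarith [norm_nonneg v]
  have h6 : √((1 - ‖u‖ ^ 2) * (1 - ‖v‖ ^ 2)) + ‖u - u'‖ * ‖v - v'‖
      ≤ √((1 - ‖u'‖ ^ 2) * (1 - ‖v'‖ ^ 2)) := by
    rw [show 1 - ‖u'‖ ^ 2 = (1 - ‖u‖ ^ 2) + ‖u - u'‖ ^ 2 by linarith,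
      show 1 - ‖v'‖ ^ 2 = (1 - ‖v‖ ^ 2) + ‖v - v'‖ ^ 2 by linarith]
    apply Real.le_sqrt_of_sq_le
    rw [Real.sqrt_mul hu1]
    have hs := Real.sq_sqrt hu1
    have ht := Real.sq_sqrt hv1
    rw [← hs, ← ht, Real.sqrt_sq (Real.sqrt_nonneg _), Real.sqrt_sq (Real.sqrt_nonneg _)]
    nlinarith [sq_nonneg (√(1 - ‖u‖ ^ 2) * ‖v - v'‖ - √(1 - ‖v‖ ^ 2) * ‖u - u'‖)]
  unfold vecFidelity
  linarith

/-- The generalized fidelity is at least `‖u'‖² + (1 - ‖u‖²) = 1 - ‖u - u'‖²`. This is where the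
error term `1 - √(1 - ε²)` originates. -/
lemma vecDist_proj_self_le {u u' : E} {ε : ℝ} (hε : 0 ≤ ε) (hu : ‖u‖ ≤ 1)
    (huu : inner ℂ u' (u - u') = 0) (h : ‖u - u'‖ ^ 2 ≤ 1 - √(1 - ε ^ 2)) :
    vecDist u' u ≤ ε := by
  have h1 := norm_sq_eq_of_inner_eq_zero huu
  have hu1 : 0 ≤ 1 - ‖u‖ ^ 2 := by nlinarith [norm_nonneg u]
  have h2 : inner ℂ u' u = ((‖u'‖ ^ 2 : ℝ) : ℂ) := by
    rw [← sub_add_cancel u u', inner_add_right, huu, zero_add,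
      inner_self_eq_norm_sq_to_K]
    norm_cast
  have h3 : √(1 - ε ^ 2) ≤ vecFidelity u' u := by
    rw [vecFidelity, h2, Complex.norm_real, Real.norm_of_nonneg (by positivity)]
    have : 1 - ‖u‖ ^ 2 ≤ √((1 - ‖u'‖ ^ 2) * (1 - ‖u‖ ^ 2)) := by
      apply Real.le_sqrt_of_sq_le
      rw [sq]
      apply mul_le_mul_of_nonneg_right _ hu1
      nlinarith [sq_nonneg ‖u - u'‖]
    linarith
  have h4 : √(1 - ε ^ 2) ^ 2 ≤ vecFidelity u' u ^ 2 := by gcongr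
  have h5 : 1 - ε ^ 2 ≤ √(1 - ε ^ 2) ^ 2 := by
    rw [Real.sq_sqrt']; exact le_max_left _ _
  refine Real.sqrt_le_iff.2 ⟨hε, by linarith⟩

end PureVectors

/-! ### Hilbert-Schmidt vectors, spectral projections and factorizations -/

section MatrixLemmas

/-- A matrix regarded as a vector of the Hilbert-Schmidt space. -/
def hsVec {m n : Type*} (X : Matrix m n ℂ) : EuclideanSpace ℂ (m × n) :=
  WithLp.toLp 2 fun p => X p.1 p.2

lemma hsVec_sub {m n : Type*} (X Y : Matrix m n ℂ) : hsVec (X - Y) = hsVec X - hsVec Y := rfl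

variable {m n k : Type*} [Fintype m] [Fintype n] [Fintype k]

lemma inner_hsVec (X Y : Matrix m n ℂ) : inner ℂ (hsVec X) (hsVec Y) = (Xᴴ * Y).trace := by
  simp only [hsVec, EuclideanSpace.inner_eq_star_dotProduct, dotProduct, Fintype.sum_prod_type,
    Matrix.trace, Matrix.diag, Matrix.mul_apply, Matrix.conjTranspose_apply]
  rw [Finset.sum_comm]
  simp [mul_comm]

lemma norm_hsVec_sq (X : Matrix m n ℂ) : ‖hsVec X‖ ^ 2 = (Xᴴ * X).trace.re := by
  rw [← inner_hsVec, inner_self_eq_norm_sq_to_K]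
  norm_cast

lemma norm_hsVec_sq' (X : Matrix m n ℂ) : ‖hsVec X‖ ^ 2 = (X * Xᴴ).trace.re := by
  rw [norm_hsVec_sq, Matrix.trace_mul_comm]

lemma norm_trace_conjTranspose_mul_le (X Y : Matrix m n ℂ) :
    ‖(Xᴴ * Y).trace‖ ≤ ‖hsVec X‖ * ‖hsVec Y‖ := by
  rw [← inner_hsVec]
  exact norm_inner_le_norm _ _

lemma trace_re_mono {A B : Matrix n n ℂ} (h : A ≤ B) : A.trace.re ≤ B.trace.re := by
  have := (Matrix.le_iff.1 h).trace_nonneg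
  rw [Matrix.trace_sub] at this
  have := (Complex.le_def.1 this).1
  simpa using this

lemma conj_mono {A B : Matrix n n ℂ} (h : A ≤ B) (C : Matrix n m ℂ) :
    Cᴴ * A * C ≤ Cᴴ * B * C := by
  have := (Matrix.le_iff.1 h).conjTranspose_mul_mul_same C
  rw [Matrix.le_iff]
  simpa [Matrix.mul_sub, Matrix.sub_mul] using this

lemma conj_mono' {A B : Matrix n n ℂ} (h : A ≤ B) (C : Matrix m n ℂ) :
    C * A * Cᴴ ≤ C * B * Cᴴ := by
  simpa using conj_mono h Cᴴ

lemma smul_le_smul_real {n : Type*} {A B : Matrix n n ℂ} {r : ℝ} (hr : 0 ≤ r) (h : A ≤ B) :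
    r • A ≤ r • B := by
  have := (Matrix.le_iff.1 h).smul hr
  rw [Matrix.le_iff, ← smul_sub]
  exact this

lemma mul_conjTranspose_le [DecidableEq m] [DecidableEq n] {X : Matrix m n ℂ} {r : ℝ} (hr : 0 < r)
    (h : Xᴴ * X ≤ r • 1) : X * Xᴴ ≤ r • 1 := by
  have h1 := conj_mono' h X
  have h2 := Matrix.posSemidef_conjTranspose_mul_self (r • (1 : Matrix m m ℂ) - X * Xᴴ)
  -- The identity `(r - X Xᴴ)² + X (r - Xᴴ X) Xᴴ = r (r - X Xᴴ)` exhibits the target as a sum of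
  -- positive terms.
  have h3 : ((r • (1 : Matrix m m ℂ) - X * Xᴴ)ᴴ * (r • (1 : Matrix m m ℂ) - X * Xᴴ)
      + (X * (r • (1 : Matrix n n ℂ)) * Xᴴ - X * (Xᴴ * X) * Xᴴ))
      = r • (r • (1 : Matrix m m ℂ) - X * Xᴴ) := by
    simp only [Matrix.conjTranspose_sub, Matrix.conjTranspose_smul, Matrix.conjTranspose_one,
      Matrix.conjTranspose_mul, Matrix.conjTranspose_conjTranspose, Matrix.mul_sub, Matrix.sub_mul,
      smul_sub, Matrix.mul_smul, Matrix.smul_mul, Matrix.mul_one, Matrix.one_mul, Matrix.mul_assoc,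
      star_trivial]
    abel
  have h4 := (h2.add (Matrix.le_iff.1 h1)).smul (inv_nonneg.2 hr.le)
  rw [h3, smul_smul, inv_mul_cancel₀ hr.ne', one_smul] at h4
  exact h4

lemma le_trace_smul_one [DecidableEq n] {A : Matrix n n ℂ} (hA : A.PosSemidef) :
    A ≤ A.trace.re • 1 := by
  rw [← Algebra.algebraMap_eq_smul_one]
  refine (le_algebraMap_iff_spectrum_le (ha := hA.1)).2 fun x hx => ?_
  rw [hA.1.spectrum_real_eq_range_eigenvalues] at hx
  obtain ⟨i, rfl⟩ := hx
  rw [hA.1.trace_eq_sum_eigenvalues]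
  simpa using Finset.single_le_sum (fun j _ => hA.eigenvalues_nonneg j) (Finset.mem_univ i)

lemma exists_spectral_projection [DecidableEq n] {H : Matrix n n ℂ} (hH : H.PosSemidef) {t : ℝ}
    (ht : 0 ≤ t) :
    ∃ P : Matrix n n ℂ, Pᴴ = P ∧ P * P = P ∧ t • P ≤ H ∧ (1 - P) * H * (1 - P) ≤ t • 1 := by
  have hc : ∀ f : ℝ → ℝ, ContinuousOn f (spectrum ℝ H) := fun f =>
    H.finite_real_spectrum.continuousOn f
  have hsa : IsSelfAdjoint H := hH.1
  -- Indicator function of `[t, ∞)`. It need not be continuous, since the spectrum is finite.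
  set g : ℝ → ℝ := fun x => if t ≤ x then 1 else 0 with hg
  have h1P : 1 - cfc g H = cfc (fun x => 1 - g x) H := by
    rw [cfc_sub _ _ _ (hc _) (hc _), cfc_const_one ℝ H]
  have hid : cfc (fun x : ℝ => x) H = H := cfc_id' ℝ H
  refine ⟨cfc g H, cfc_predicate g H, ?_, ?_, ?_⟩
  · rw [← cfc_mul _ _ _ (hc _) (hc _)]
    congr 1
    ext x
    simp [hg]
  · conv_rhs => rw [← hid]
    rw [← cfc_smul _ _ _ (hc _)]
    refine cfc_mono (fun x hx => ?_) (hc _) (hc _)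
    have := spectrum_nonneg_of_nonneg hH.nonneg hx
    by_cases h : t ≤ x <;> simp [hg, h, this]
  · rw [h1P]
    conv_lhs => enter [1, 2]; rw [← hid]
    rw [← cfc_mul _ _ _ (hc _) (hc _), ← cfc_mul _ _ _ (hc _) (hc _),
      ← Algebra.algebraMap_eq_smul_one, ← cfc_const t H]
    refine cfc_mono (fun x hx => ?_) (hc _) (hc _)
    by_cases h : t ≤ x
    · simp [hg, h, ht]
    · simp [hg, h, (not_le.1 h).le]

lemma norm_toEuclideanLin_sq [DecidableEq n] (A : Matrix m n ℂ) (x : EuclideanSpace ℂ n) :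
    ‖Matrix.toEuclideanLin A x‖ ^ 2 = (star x.ofLp ⬝ᵥ ((Aᴴ * A) *ᵥ x.ofLp)).re := by
  have h : ((‖Matrix.toEuclideanLin A x‖ : ℂ)) ^ 2 = star x.ofLp ⬝ᵥ ((Aᴴ * A) *ᵥ x.ofLp) := by
    refine (inner_self_eq_norm_sq_to_K (𝕜 := ℂ) (Matrix.toEuclideanLin A x)).symm.trans ?_
    rw [EuclideanSpace.inner_eq_star_dotProduct, Matrix.ofLp_toLpLin, Matrix.toLin'_apply,
      Matrix.star_mulVec, dotProduct_comm, Matrix.dotProduct_mulVec, Matrix.vecMul_vecMul,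
      ← Matrix.dotProduct_mulVec]
  rw [← h]
  norm_cast

lemma norm_toEuclideanLin_le_of_le [DecidableEq n] {A : Matrix m n ℂ} {B : Matrix k n ℂ}
    (h : Aᴴ * A ≤ Bᴴ * B) (x : EuclideanSpace ℂ n) :
    ‖Matrix.toEuclideanLin A x‖ ≤ ‖Matrix.toEuclideanLin B x‖ := by
  rw [← sq_le_sq₀ (norm_nonneg _) (norm_nonneg _), norm_toEuclideanLin_sq, norm_toEuclideanLin_sq]
  have := (Matrix.le_iff.1 h).re_dotProduct_nonneg x.ofLp
  rw [Matrix.sub_mulVec, dotProduct_sub, map_sub] at this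
  exact sub_nonneg.1 this

lemma conjTranspose_mul_self_le_one [DecidableEq n] {A : Matrix m n ℂ}
    (h : ∀ x, ‖Matrix.toEuclideanLin A x‖ ≤ ‖x‖) : Aᴴ * A ≤ 1 := by
  rw [Matrix.le_iff]
  have hherm : (1 - Aᴴ * A).IsHermitian :=
    Matrix.isHermitian_one.sub (Matrix.isHermitian_conjTranspose_mul_self A)
  refine Matrix.PosSemidef.of_dotProduct_mulVec_nonneg hherm fun x => ?_
  have him : (star x ⬝ᵥ ((1 - Aᴴ * A) *ᵥ x)).im = 0 := hherm.im_star_dotProduct_mulVec_self x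
  have hx := (sq_le_sq₀ (norm_nonneg _) (norm_nonneg _)).2 (h (WithLp.toLp 2 x))
  rw [norm_toEuclideanLin_sq] at hx
  have h1 : ‖WithLp.toLp 2 x‖ ^ 2 = (star x ⬝ᵥ x).re := by
    have := norm_toEuclideanLin_sq (1 : Matrix n n ℂ) (WithLp.toLp 2 x)
    simpa using this
  rw [h1] at hx
  refine Complex.le_def.2 ⟨?_, by simpa using him.symm⟩
  rw [Matrix.sub_mulVec, dotProduct_sub, Matrix.one_mulVec]
  simpa using hx

/-- Douglas' factorization lemma. -/
lemma exists_contraction_mul_eq [DecidableEq n] [DecidableEq k] {A : Matrix m n ℂ}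
    {B : Matrix k n ℂ} (h : Aᴴ * A ≤ Bᴴ * B) : ∃ K : Matrix m k ℂ, K * B = A ∧ Kᴴ * K ≤ 1 := by
  set A' := Matrix.toEuclideanLin A
  set B' := Matrix.toEuclideanLin B
  have hle : ∀ x, ‖A' x‖ ≤ ‖B' x‖ := norm_toEuclideanLin_le_of_le h
  obtain ⟨g, hg⟩ := B'.rangeRestrict.exists_rightInverse_of_surjective B'.range_rangeRestrict
  have hBg : ∀ y : B'.range, B' (g y) = y := fun y =>
    congrArg Subtype.val (LinearMap.congr_fun hg y)
  -- The section `g` chooses arbitrary preimages; the choice is harmless because `A'` vanishes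
  -- wherever `B'` does.
  have hAg : ∀ x, A' (g (B'.rangeRestrict x)) = A' x := by
    intro x
    rw [← sub_eq_zero, ← map_sub, ← norm_le_zero_iff]
    refine (hle _).trans (le_of_eq ?_)
    rw [map_sub, hBg]
    simp
  set K' : EuclideanSpace ℂ k →ₗ[ℂ] EuclideanSpace ℂ m :=
    A' ∘ₗ g ∘ₗ (B'.range.orthogonalProjectionOnto : EuclideanSpace ℂ k →ₗ[ℂ] B'.range)
  have hK : ∀ y, ‖K' y‖ ≤ ‖y‖ := by
    intro y
    refine (hle _).trans ?_
    rw [LinearMap.comp_apply, hBg]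
    exact B'.range.norm_orthogonalProjectionOnto_apply_le y
  have hKB : K' ∘ₗ B' = A' := by
    ext1 x
    have : B'.range.orthogonalProjectionOnto (B' x) = B'.rangeRestrict x :=
      Submodule.orthogonalProjectionOnto_mem_subspace_eq_self (B'.rangeRestrict x)
    simp [K', this, hAg]
  refine ⟨Matrix.toEuclideanLin.symm K', ?_, conjTranspose_mul_self_le_one fun y => ?_⟩
  · apply Matrix.toEuclideanLin.injective
    rw [Matrix.toLpLin_mul (q := 2), LinearEquiv.apply_symm_apply]
    exact hKB
  · simpa using hK y

/-- With equality, the Douglas factor is isometric on the range of `B`, and an isometry defined on a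
subspace extends to the whole finite-dimensional space. -/
lemma exists_unitary_mul_eq [DecidableEq n] [DecidableEq k] {A B : Matrix k n ℂ}
    (h : Aᴴ * A = Bᴴ * B) : ∃ U : Matrix k k ℂ, U * B = A ∧ Uᴴ * U = 1 := by
  obtain ⟨K, hK, -⟩ := exists_contraction_mul_eq h.le
  set A' := Matrix.toEuclideanLin A
  set B' := Matrix.toEuclideanLin B
  have hn : ∀ x, ‖A' x‖ = ‖B' x‖ := fun x =>
    le_antisymm (norm_toEuclideanLin_le_of_le h.le x) (norm_toEuclideanLin_le_of_le h.ge x)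
  have hKB : ∀ x, Matrix.toEuclideanLin K (B' x) = A' x := by
    intro x
    simp only [A', ← hK, Matrix.toLpLin_mul (q := 2)]
    rfl
  let L : B'.range →ₗᵢ[ℂ] EuclideanSpace ℂ k :=
    { toLinearMap := (Matrix.toEuclideanLin K).domRestrict B'.range
      norm_map' := by
        rintro ⟨_, x, rfl⟩
        exact (congrArg norm (hKB x)).trans (hn x) }
  have hLB : ∀ x, L.extend (B' x) = A' x := fun x =>
    (L.extend_apply ⟨B' x, LinearMap.mem_range_self B' x⟩).trans (hKB x)
  set U := Matrix.toEuclideanLin.symm L.extend.toLinearMap with hU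
  have hU' : ∀ x, Matrix.toEuclideanLin U x = L.extend x := fun x => by
    rw [hU, LinearEquiv.apply_symm_apply]; rfl
  have hUB : U * B = A := by
    apply Matrix.toEuclideanLin.injective
    ext1 x
    rw [Matrix.toLpLin_mul (q := 2)]
    exact (hU' _).trans (hLB x)
  refine ⟨U, hUB, ?_⟩
  rw [← Matrix.toEuclideanLin.injective.eq_iff, Matrix.toLpLin_mul (q := 2),
    Matrix.toEuclideanLin_conjTranspose_eq_adjoint, Matrix.toLpLin_one, hU,
    LinearEquiv.apply_symm_apply]
  refine LinearMap.ext fun x => ext_inner_left ℂ fun y => ?_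
  rw [LinearMap.comp_apply, LinearMap.adjoint_inner_right]
  exact L.extend.inner_map_map y x

end MatrixLemmas

/-! ### Trace norm, fidelity and Uhlmann's theorem -/

section Fidelity

variable {m n k : Type*} [Fintype m] [Fintype n] [DecidableEq n] [Fintype k]

lemma posSemidef_sqrt (A : Matrix n n ℂ) : (CFC.sqrt A).PosSemidef :=
  Matrix.nonneg_iff_posSemidef.1 (CFC.sqrt_nonneg A)

lemma conjTranspose_sqrt (A : Matrix n n ℂ) : (CFC.sqrt A)ᴴ = CFC.sqrt A :=
  (posSemidef_sqrt A).1

lemma sqrt_mul_sqrt {A : Matrix n n ℂ} (hA : A.PosSemidef) : CFC.sqrt A * CFC.sqrt A = A :=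
  CFC.sqrt_mul_sqrt_self A hA.nonneg

lemma contraction_mul [DecidableEq k] {A : Matrix m n ℂ} {B : Matrix n k ℂ}
    (hA : Aᴴ * A ≤ 1) (hB : Bᴴ * B ≤ 1) :
    (A * B)ᴴ * (A * B) ≤ 1 := by
  have h := conj_mono hA B
  rw [Matrix.mul_one] at h
  refine le_trans (le_of_eq ?_) (h.trans hB)
  simp only [Matrix.conjTranspose_mul, Matrix.mul_assoc]

lemma contraction_conjTranspose [DecidableEq m] {A : Matrix m n ℂ} (hA : Aᴴ * A ≤ 1) :
    Aᴴᴴ * Aᴴ ≤ 1 := by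
  have := mul_conjTranspose_le (X := A) one_pos (by simpa using hA)
  simpa using this

lemma norm_trace_mul_le_trace {H C : Matrix n n ℂ} (hH : H.PosSemidef) (hC : Cᴴ * C ≤ 1) :
    ‖(H * C).trace‖ ≤ H.trace.re := by
  set Q := CFC.sqrt H with hQ
  have hQQ : Q * Q = H := sqrt_mul_sqrt hH
  have hQh : Qᴴ = Q := conjTranspose_sqrt H
  have h1 : (H * C).trace = (Qᴴ * (C * Q)).trace := by
    rw [← hQQ, hQh, ← Matrix.mul_assoc, Matrix.trace_mul_comm (Q * C), Matrix.mul_assoc]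
  have h2 : ‖hsVec Q‖ ^ 2 = H.trace.re := by rw [norm_hsVec_sq, hQh, hQQ]
  have h3 : ‖hsVec (C * Q)‖ ^ 2 ≤ H.trace.re := by
    rw [norm_hsVec_sq]
    have := trace_re_mono (conj_mono hC Q)
    rw [Matrix.mul_one, hQh, hQQ] at this
    simpa only [Matrix.conjTranspose_mul, Matrix.mul_assoc, hQh] using this
  rw [h1]
  refine (norm_trace_conjTranspose_mul_le _ _).trans ?_
  nlinarith [sq_nonneg (‖hsVec Q‖ - ‖hsVec (C * Q)‖)]

lemma norm_trace_mul_le_traceNorm (X : Matrix n n ℂ) {V : Matrix n n ℂ} (hV : Vᴴ * V ≤ 1) :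
    ‖(X * V).trace‖ ≤ traceNorm X := by
  have hX := Matrix.posSemidef_conjTranspose_mul_self X
  obtain ⟨W, hW, hW1⟩ := exists_contraction_mul_eq (A := X) (B := CFC.sqrt (Xᴴ * X))
    (by rw [conjTranspose_sqrt, sqrt_mul_sqrt hX])
  have := norm_trace_mul_le_trace (posSemidef_sqrt (Xᴴ * X)) (contraction_mul hV hW1)
  rwa [← Matrix.mul_assoc, Matrix.trace_mul_comm, ← Matrix.mul_assoc, hW] at this

lemma exists_unitary_trace_eq_traceNorm (X : Matrix n n ℂ) :
    ∃ U : Matrix n n ℂ, Uᴴ * U = 1 ∧ (Uᴴ * X).trace = traceNorm X := by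
  have hX := Matrix.posSemidef_conjTranspose_mul_self X
  obtain ⟨U, hU, hU1⟩ := exists_unitary_mul_eq (A := X) (B := CFC.sqrt (Xᴴ * X))
    (by rw [conjTranspose_sqrt, sqrt_mul_sqrt hX])
  refine ⟨U, hU1, ?_⟩
  conv_lhs => rw [← hU, ← Matrix.mul_assoc, hU1, Matrix.one_mul]
  have := (posSemidef_sqrt (Xᴴ * X)).trace_nonneg
  exact (Complex.ext rfl (by simpa using (Complex.le_def.1 this).2.symm))

/-- The overlap of two purifications is bounded by the fidelity. -/
lemma norm_trace_le_fidelity [DecidableEq m] [DecidableEq k] (R : Matrix n m ℂ)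
    (S : Matrix n k ℂ) {V : Matrix k m ℂ}
    (hV : Vᴴ * V ≤ 1) : ‖(Rᴴ * S * V).trace‖ ≤ fidelity (R * Rᴴ) (S * Sᴴ) := by
  have hR := Matrix.posSemidef_self_mul_conjTranspose R
  have hS := Matrix.posSemidef_self_mul_conjTranspose S
  obtain ⟨K, hK, hK1⟩ := exists_contraction_mul_eq (A := Rᴴ) (B := CFC.sqrt (R * Rᴴ))
    (by rw [conjTranspose_sqrt, sqrt_mul_sqrt hR, Matrix.conjTranspose_conjTranspose])
  obtain ⟨L, hL, hL1⟩ := exists_contraction_mul_eq (A := Sᴴ) (B := CFC.sqrt (S * Sᴴ))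
    (by rw [conjTranspose_sqrt, sqrt_mul_sqrt hS, Matrix.conjTranspose_conjTranspose])
  have hS' : S = CFC.sqrt (S * Sᴴ) * Lᴴ := by
    have := congrArg Matrix.conjTranspose hL
    rwa [Matrix.conjTranspose_mul, conjTranspose_sqrt, Matrix.conjTranspose_conjTranspose,
      eq_comm] at this
  have h := norm_trace_mul_le_traceNorm (CFC.sqrt (R * Rᴴ) * CFC.sqrt (S * Sᴴ))
    (contraction_mul (contraction_mul (contraction_conjTranspose hL1) hV) hK1)
  refine le_trans (le_of_eq ?_) h
  have e : Rᴴ * S * V = K * (CFC.sqrt (R * Rᴴ) * CFC.sqrt (S * Sᴴ) * (Lᴴ * V)) := by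
    calc Rᴴ * S * V = K * CFC.sqrt (R * Rᴴ) * (CFC.sqrt (S * Sᴴ) * Lᴴ) * V := by rw [hK, ← hS']
      _ = _ := by simp only [Matrix.mul_assoc]
  rw [e, Matrix.trace_mul_comm]
  simp only [Matrix.mul_assoc]

/-- Uhlmann's theorem. -/
lemma exists_purification (R : Matrix n n ℂ) {ρ : Matrix n n ℂ} (hρ : ρ.PosSemidef) :
    ∃ S : Matrix n n ℂ, S * Sᴴ = ρ ∧ (Sᴴ * R).trace = fidelity ρ (R * Rᴴ) := by
  have hR := Matrix.posSemidef_self_mul_conjTranspose R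
  obtain ⟨U, hU, hU1⟩ := exists_unitary_mul_eq (A := Rᴴ) (B := CFC.sqrt (R * Rᴴ))
    (by rw [conjTranspose_sqrt, sqrt_mul_sqrt hR, Matrix.conjTranspose_conjTranspose])
  have hR' : R = CFC.sqrt (R * Rᴴ) * Uᴴ := by
    have := congrArg Matrix.conjTranspose hU
    rwa [Matrix.conjTranspose_mul, conjTranspose_sqrt, Matrix.conjTranspose_conjTranspose,
      eq_comm] at this
  obtain ⟨W, hW, hWt⟩ := exists_unitary_trace_eq_traceNorm (CFC.sqrt ρ * CFC.sqrt (R * Rᴴ))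
  have hW' : W * Wᴴ = 1 := mul_eq_one_comm.1 hW
  refine ⟨CFC.sqrt ρ * W * Uᴴ, ?_, ?_⟩
  · simp only [Matrix.conjTranspose_mul, Matrix.conjTranspose_conjTranspose, conjTranspose_sqrt]
    calc CFC.sqrt ρ * W * Uᴴ * (U * (Wᴴ * CFC.sqrt ρ))
        = CFC.sqrt ρ * (W * (Uᴴ * U) * Wᴴ) * CFC.sqrt ρ := by simp only [Matrix.mul_assoc]
      _ = ρ := by rw [hU1, Matrix.mul_one, hW', Matrix.mul_one, sqrt_mul_sqrt hρ]
  · rw [fidelity, ← hWt]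
    conv_lhs => rw [hR']
    simp only [Matrix.conjTranspose_mul, Matrix.conjTranspose_conjTranspose, conjTranspose_sqrt]
    rw [← Matrix.mul_assoc, Matrix.trace_mul_comm]
    simp only [← Matrix.mul_assoc, hU1, Matrix.one_mul]

lemma fidelity_nonneg (ρ σ : Matrix n n ℂ) : 0 ≤ fidelity ρ σ :=
  (Complex.le_def.1 (posSemidef_sqrt _).trace_nonneg).1

lemma fidelity_le {ρ σ : Matrix n n ℂ} (hρ : ρ.PosSemidef) (hσ : σ.PosSemidef) :
    fidelity ρ σ ≤ √ρ.trace.re * √σ.trace.re := by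
  obtain ⟨R, hR, hR'⟩ := exists_purification (CFC.sqrt σ) hρ
  rw [conjTranspose_sqrt, sqrt_mul_sqrt hσ] at hR'
  have h := norm_trace_conjTranspose_mul_le R (CFC.sqrt σ)
  rw [hR', Complex.norm_real, Real.norm_of_nonneg (fidelity_nonneg _ _)] at h
  have h1 : ‖hsVec R‖ = √ρ.trace.re := by
    rw [← hR, ← norm_hsVec_sq', Real.sqrt_sq (norm_nonneg _)]
  have h2 : ‖hsVec (CFC.sqrt σ)‖ = √σ.trace.re := by
    rw [← Real.sqrt_sq (norm_nonneg (hsVec _)), norm_hsVec_sq, conjTranspose_sqrt,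
      sqrt_mul_sqrt hσ]
  rwa [h1, h2] at h

lemma fidelity_self {ρ : Matrix n n ℂ} (hρ : ρ.PosSemidef) : fidelity ρ ρ = ρ.trace.re := by
  rw [fidelity, traceNorm, sqrt_mul_sqrt hρ, hρ.1, CFC.sqrt_mul_self ρ hρ.nonneg]

lemma mem_closeStates_self {ρ : Matrix n n ℂ} (hρ : IsSubState ρ) {ε : ℝ} (hε : 0 ≤ ε) :
    ρ ∈ closeStates ε ρ := by
  refine ⟨hρ, ?_⟩
  have h : 0 ≤ 1 - ρ.trace.re := sub_nonneg.2 hρ.2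
  simpa [purifiedDist, genFidelity, fidelity_self hρ.1, Real.sqrt_mul_self h] using hε

lemma purifiedDist_le_vecDist [DecidableEq m] (R S : Matrix n m ℂ) :
    purifiedDist (R * Rᴴ) (S * Sᴴ) ≤ vecDist (hsVec R) (hsVec S) := by
  have h := norm_trace_le_fidelity R S (V := (1 : Matrix m m ℂ)) (by simp)
  rw [Matrix.mul_one, ← inner_hsVec] at h
  have h0 := vecFidelity_nonneg (hsVec R) (hsVec S)
  have hle : vecFidelity (hsVec R) (hsVec S) ≤ genFidelity (R * Rᴴ) (S * Sᴴ) := by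
    rw [vecFidelity, genFidelity, norm_hsVec_sq', norm_hsVec_sq']
    linarith
  exact Real.sqrt_le_sqrt (by gcongr)

lemma vecDist_eq_purifiedDist {R S : Matrix n m ℂ}
    (h : (Rᴴ * S).trace = fidelity (R * Rᴴ) (S * Sᴴ)) :
    vecDist (hsVec R) (hsVec S) = purifiedDist (R * Rᴴ) (S * Sᴴ) := by
  rw [vecDist, purifiedDist, vecFidelity, genFidelity, norm_hsVec_sq', norm_hsVec_sq', inner_hsVec,
    h, Complex.norm_real, Real.norm_of_nonneg (fidelity_nonneg _ _)]

lemma norm_hsVec_le_one {m n : Type*} [Fintype m] [Fintype n] {R : Matrix n m ℂ} (h : IsSubState (R * Rᴴ)) : ‖hsVec R‖ ≤ 1 := by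
  have := h.2
  rw [← norm_hsVec_sq'] at this
  nlinarith [norm_nonneg (hsVec R)]

end Fidelity

/-! ### Moving a tensor factor across the bipartition of a pure vector -/

section Fold

variable {a β d γ : Type*}

/-- Move the first tensor factor from the row index to the column index. -/
def foldFst (R : Matrix (a × β) d ℂ) : Matrix β (a × d) ℂ :=
  Matrix.of fun i p => R (p.1, i) p.2

/-- Move the first tensor factor from the column index to the row index. -/
def unfoldFst (X : Matrix β (a × d) ℂ) : Matrix (a × β) d ℂ :=
  Matrix.of fun p j => X p.2 (p.1, j)

lemma traceFst_mul_conjTranspose [Fintype a] [Fintype d] (R : Matrix (a × β) d ℂ) :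
    traceFst (R * Rᴴ) = foldFst R * (foldFst R)ᴴ := by
  ext i j
  simp [traceFst, foldFst, Matrix.mul_apply, Fintype.sum_prod_type]

lemma unfoldFst_conjTranspose_mul [Fintype a] [Fintype β] (X : Matrix β (a × d) ℂ) :
    (unfoldFst X)ᴴ * unfoldFst X = traceFst (Xᴴ * X) := by
  ext i j
  simp [traceFst, unfoldFst, Matrix.mul_apply, Fintype.sum_prod_type]

lemma trace_unfoldFst [Fintype a] [Fintype β] [Fintype d] (X Y : Matrix β (a × d) ℂ) :
    ((unfoldFst X)ᴴ * unfoldFst Y).trace = (Xᴴ * Y).trace := by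
  simp only [Matrix.trace, Matrix.diag, Matrix.mul_apply, Matrix.conjTranspose_apply, unfoldFst,
    Matrix.of_apply, Fintype.sum_prod_type]
  rw [Finset.sum_comm]

lemma inner_unfoldFst [Fintype a] [Fintype β] [Fintype d] (X Y : Matrix β (a × d) ℂ) :
    inner ℂ (hsVec (unfoldFst X)) (hsVec (unfoldFst Y)) = inner ℂ (hsVec X) (hsVec Y) := by
  rw [inner_hsVec, inner_hsVec, trace_unfoldFst]

lemma norm_unfoldFst [Fintype a] [Fintype β] [Fintype d] (X : Matrix β (a × d) ℂ) :
    ‖hsVec (unfoldFst X)‖ = ‖hsVec X‖ := by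
  rw [← sq_eq_sq₀ (norm_nonneg _) (norm_nonneg _), norm_hsVec_sq, norm_hsVec_sq, trace_unfoldFst]

lemma vecDist_unfoldFst [Fintype a] [Fintype β] [Fintype d] (X Y : Matrix β (a × d) ℂ) :
    vecDist (hsVec (unfoldFst X)) (hsVec (unfoldFst Y)) = vecDist (hsVec X) (hsVec Y) := by
  rw [vecDist, vecFidelity, inner_unfoldFst, norm_unfoldFst, norm_unfoldFst, vecDist, vecFidelity]

lemma unfoldFst_mul [Fintype a] [DecidableEq a] [Fintype β] (B : Matrix γ β ℂ)
    (X : Matrix β (a × d) ℂ) :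
    unfoldFst (B * X) = ((1 : Matrix a a ℂ) ⊗ₖ B) * unfoldFst X := by
  ext p j
  simp [unfoldFst, Matrix.mul_apply, Fintype.sum_prod_type, Matrix.one_apply]

lemma traceFst_mono [Fintype a] [Fintype β] {X Y : Matrix (a × β) (a × β) ℂ} (h : X ≤ Y) :
    traceFst X ≤ traceFst Y := by
  have h' : traceFst Y - traceFst X
      = ∑ k : a, (Y - X).submatrix (fun i : β => (k, i)) (fun i => (k, i)) := by
    ext i j
    simp [traceFst, Matrix.sum_apply]
  rw [Matrix.le_iff, h']
  exact Matrix.posSemidef_sum _ fun k _ => (Matrix.le_iff.1 h).submatrix _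

lemma traceFst_smul [Fintype a] (r : ℝ) (X : Matrix (a × β) (a × β) ℂ) :
    traceFst (r • X) = r • traceFst X := by
  ext i j
  simp [traceFst, Finset.mul_sum]

end Fold

/-! ### Projections obtained from entropy bounds -/

section ChainRule

lemma inner_hsVec_mul_proj {m n : Type*} [Fintype m] [Fintype n] {P : Matrix n n ℂ} (hP : Pᴴ = P)
    (hPP : P * P = P) (X Y : Matrix m n ℂ) :
    inner ℂ (hsVec (X * P)) (hsVec Y - hsVec (Y * P)) = 0 := by
  rw [← hsVec_sub, inner_hsVec, Matrix.conjTranspose_mul, hP, Matrix.mul_assoc,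
    Matrix.trace_mul_comm, Matrix.mul_assoc, Matrix.sub_mul, Matrix.mul_assoc Y, hPP, sub_self,
    Matrix.mul_zero, Matrix.trace_zero]

lemma one_kronecker_conj {a β γ : Type*} [Fintype a] [DecidableEq a] [Fintype γ]
    (B : Matrix β γ ℂ) :
    ((1 : Matrix a a ℂ) ⊗ₖ B) * ((1 : Matrix a a ℂ) ⊗ₖ B)ᴴ = (1 : Matrix a a ℂ) ⊗ₖ (B * Bᴴ) := by
  rw [Matrix.conjTranspose_kronecker, ← Matrix.mul_kronecker_mul, Matrix.conjTranspose_one,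
    Matrix.mul_one]

variable {a b c d β e : Type*} [Fintype a] [DecidableEq a] [Fintype b] [DecidableEq b]
  [Fintype c] [Fintype d] [DecidableEq d] [Fintype β] [DecidableEq β]
  [Fintype e] [DecidableEq e]

/-- A min-entropy bound for `ABC` yields a projection of small trace on the complement of `C` that
barely disturbs the purification. -/
lemma exists_projection_of_le [DecidableEq c] {R : Matrix (a × b × c) d ℂ} {σ : Matrix c c ℂ} (hσ : IsSubState σ)
    {r δ : ℝ} (hr : 0 < r) (hδ : 0 < δ)
    (h : R * Rᴴ ≤ r • ((1 : Matrix a a ℂ) ⊗ₖ ((1 : Matrix b b ℂ) ⊗ₖ σ))) :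
    ∃ P : Matrix (b × a × d) (b × a × d) ℂ, Pᴴ = P ∧ P * P = P ∧
      traceFst (traceFst P) ≤ (r / δ) • 1 ∧
      ‖hsVec (foldFst (foldFst R)) - hsVec (foldFst (foldFst R) * P)‖ ^ 2 ≤ δ := by
  set Q := CFC.sqrt σ with hQ
  have hQh : Qᴴ = Q := conjTranspose_sqrt σ
  have hQQ : Q * Q = σ := sqrt_mul_sqrt hσ.1
  set S : Matrix (a × b × c) (a × b × c) ℂ := (1 : Matrix a a ℂ) ⊗ₖ ((1 : Matrix b b ℂ) ⊗ₖ Q)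
    with hS
  have hSh : Sᴴ = S := by
    simp only [hS, Matrix.conjTranspose_kronecker, Matrix.conjTranspose_one, hQh]
  have hSS : S * S = (1 : Matrix a a ℂ) ⊗ₖ ((1 : Matrix b b ℂ) ⊗ₖ σ) := by
    simp only [hS, ← Matrix.mul_kronecker_mul, Matrix.one_mul, hQQ]
  have hrr : √r * √r = r := Real.mul_self_sqrt hr.le
  obtain ⟨K, hK, hK1⟩ := exists_contraction_mul_eq (A := Rᴴ) (B := √r • S) (by
    rw [Matrix.conjTranspose_conjTranspose, Matrix.conjTranspose_smul, hSh, star_trivial,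
      Matrix.smul_mul, Matrix.mul_smul, smul_smul, hrr, hSS]
    exact h)
  set L := √r • Kᴴ with hL
  have hRL : R = S * L := by
    have := congrArg Matrix.conjTranspose hK
    rw [Matrix.conjTranspose_conjTranspose, Matrix.conjTranspose_mul, Matrix.conjTranspose_smul,
      star_trivial, hSh, Matrix.smul_mul] at this
    rw [← this, hL, Matrix.mul_smul]
  have hLL : Lᴴ * L ≤ r • 1 := by
    rw [hL, Matrix.conjTranspose_smul, star_trivial, Matrix.smul_mul, Matrix.mul_smul, smul_smul,
      hrr]
    exact smul_le_smul_real hr.le (contraction_conjTranspose hK1)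
  set N := foldFst (foldFst L) with hN
  have hT : foldFst (foldFst R) = Q * N := by
    have h1 : R = unfoldFst (unfoldFst (Q * N)) := by
      rw [unfoldFst_mul, unfoldFst_mul, hRL]
      rfl
    rw [h1]
    rfl
  obtain ⟨P, hP, hPP, hP1, hP2⟩ :=
    exists_spectral_projection (Matrix.posSemidef_conjTranspose_mul_self N) hδ.le
  refine ⟨P, hP, hPP, ?_, ?_⟩
  · have h1 := traceFst_mono (traceFst_mono hP1)
    rw [traceFst_smul, traceFst_smul, ← unfoldFst_conjTranspose_mul,
      ← unfoldFst_conjTranspose_mul] at h1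
    have h2 := smul_le_smul_real (inv_nonneg.2 hδ.le) (h1.trans hLL)
    rwa [smul_smul, smul_smul, inv_mul_cancel₀ hδ.ne', one_smul, inv_mul_eq_div] at h2
  · have h1 : (N * (1 - P))ᴴ * (N * (1 - P)) ≤ δ • 1 := by
      refine le_trans (le_of_eq ?_) hP2
      simp only [Matrix.conjTranspose_mul, Matrix.conjTranspose_sub, Matrix.conjTranspose_one, hP,
        Matrix.mul_assoc]
    have h2 := trace_re_mono (conj_mono' (mul_conjTranspose_le hδ h1) Q)
    have h3 : (Q * (δ • (1 : Matrix c c ℂ)) * Qᴴ).trace.re = δ * σ.trace.re := by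
      rw [Matrix.mul_smul, Matrix.mul_one, Matrix.smul_mul, hQh, hQQ, Matrix.trace_smul,
        Complex.smul_re, smul_eq_mul]
    rw [hT, ← hsVec_sub, show Q * N - Q * N * P = Q * (N * (1 - P)) by
      rw [Matrix.mul_sub, Matrix.mul_sub, Matrix.mul_one, Matrix.mul_assoc], norm_hsVec_sq']
    calc (Q * (N * (1 - P)) * (Q * (N * (1 - P)))ᴴ).trace.re
        = (Q * (N * (1 - P) * (N * (1 - P))ᴴ) * Qᴴ).trace.re := by
          simp only [Matrix.conjTranspose_mul, Matrix.mul_assoc]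
      _ ≤ δ * σ.trace.re := h2.trans h3.le
      _ ≤ δ := mul_le_of_le_one_right hδ.le hσ.2

/-- Since `P` is idempotent, `T * P` can be pulled out as an operator on the row side, leaving `L =
unfoldFst P * Y`, for which `Lᴴ * L` is exactly the compressed partial trace of `P`. -/
lemma unfoldFst_proj_mul_le {T : Matrix c (b × e) ℂ} {P : Matrix (b × e) (b × e) ℂ} (hP : Pᴴ = P)
    (hPP : P * P = P) {Y : Matrix e e ℂ} {s : ℝ} (hs : 0 < s)
    (h : Yᴴ * traceFst P * Y ≤ s • 1) :
    (unfoldFst (T * P) * Y) * (unfoldFst (T * P) * Y)ᴴ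
      ≤ s • ((1 : Matrix b b ℂ) ⊗ₖ (T * P * (T * P)ᴴ)) := by
  set L := unfoldFst P * Y with hL
  have hLL : Lᴴ * L ≤ s • 1 := by
    refine le_trans (le_of_eq ?_) h
    have := unfoldFst_conjTranspose_mul P
    rw [hP, hPP] at this
    rw [hL, Matrix.conjTranspose_mul, ← this]
    simp only [Matrix.mul_assoc]
  have hX : unfoldFst (T * P) * Y = ((1 : Matrix b b ℂ) ⊗ₖ (T * P)) * L := by
    rw [hL, ← Matrix.mul_assoc, ← unfoldFst_mul, Matrix.mul_assoc T, hPP]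
  have h1 := conj_mono' (mul_conjTranspose_le hs hLL) ((1 : Matrix b b ℂ) ⊗ₖ (T * P))
  rw [Matrix.mul_smul, Matrix.mul_one, Matrix.smul_mul, one_kronecker_conj] at h1
  refine le_trans (le_of_eq ?_) h1
  rw [hX, Matrix.conjTranspose_mul]
  simp only [Matrix.mul_assoc]

/-- The max-entropy of `A` given `β` bounds the weight of projections with small partial trace on
the complement of `β`. -/
lemma norm_foldFst_mul_proj_sq_le {R : Matrix (a × β) d ℂ} {P : Matrix (a × d) (a × d) ℂ}
    (hP : Pᴴ = P) (hPP : P * P = P) {r M : ℝ} (hr : 0 < r) (hM : 0 ≤ M)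
    (h : traceFst P ≤ r • 1)
    (hF : ∀ σ : Matrix β β ℂ, IsSubState σ →
      fidelity (R * Rᴴ) ((1 : Matrix a a ℂ) ⊗ₖ σ) ^ 2 ≤ M) :
    ‖hsVec (foldFst R * P)‖ ^ 2 ≤ M * r := by
  set X := foldFst R with hX
  set w := ‖hsVec (X * P)‖ ^ 2 with hw
  rcases (sq_nonneg ‖hsVec (X * P)‖).eq_or_lt with hw0 | hw0
  · rw [hw, ← hw0]; positivity
  rw [← hw] at hw0
  -- The test state for the max-entropy is the normalized marginal of the projected vector; its
  -- overlap with `R` through the contraction `V` is `√(w / r)`.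
  set S := (√w)⁻¹ • (X * P) with hS
  set V := (√r)⁻¹ • unfoldFst P with hV
  have hV1 : Vᴴ * V ≤ 1 := by
    have h1 := unfoldFst_conjTranspose_mul P
    rw [hP, hPP] at h1
    rw [hV, Matrix.conjTranspose_smul, star_trivial, Matrix.smul_mul, Matrix.mul_smul, smul_smul,
      h1, ← mul_inv, Real.mul_self_sqrt hr.le]
    have h2 := smul_le_smul_real (inv_nonneg.2 hr.le) h
    rwa [smul_smul, inv_mul_cancel₀ hr.ne', one_smul] at h2
  have hSsub : IsSubState (S * Sᴴ) := by
    refine ⟨Matrix.posSemidef_self_mul_conjTranspose S, ?_⟩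
    rw [hS, Matrix.conjTranspose_smul, star_trivial, Matrix.smul_mul, Matrix.mul_smul, smul_smul,
      Matrix.trace_smul, Complex.smul_re, smul_eq_mul, ← norm_hsVec_sq', ← hw, ← mul_inv,
      Real.mul_self_sqrt hw0.le, inv_mul_cancel₀ hw0.ne']
  have h1 := norm_trace_le_fidelity R ((1 : Matrix a a ℂ) ⊗ₖ S) hV1
  rw [one_kronecker_conj] at h1
  have h2 : (Rᴴ * ((1 : Matrix a a ℂ) ⊗ₖ S) * V).trace = (((√r)⁻¹ * (√w)⁻¹ * w : ℝ) : ℂ) := by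
    have h3 : ((1 : Matrix a a ℂ) ⊗ₖ S) * V = (√r)⁻¹ • (√w)⁻¹ • unfoldFst (X * P) := by
      rw [hV, Matrix.mul_smul, ← unfoldFst_mul, hS, Matrix.smul_mul, Matrix.mul_assoc, hPP]
      rfl
    have h4 : (Rᴴ * unfoldFst (X * P)).trace = (w : ℂ) := by
      have h5 : (Rᴴ * unfoldFst (X * P)).trace = (Xᴴ * (X * P)).trace := trace_unfoldFst X (X * P)
      have h6 : (Xᴴ * (X * P)).trace = ((X * P)ᴴ * (X * P)).trace := by
        rw [Matrix.conjTranspose_mul, hP, Matrix.mul_assoc P, Matrix.trace_mul_comm P]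
        simp only [Matrix.mul_assoc, hPP]
      rw [h5, h6, ← inner_hsVec, inner_self_eq_norm_sq_to_K, hw]
      norm_cast
    rw [Matrix.mul_assoc, h3, Matrix.mul_smul, Matrix.mul_smul, Matrix.trace_smul,
      Matrix.trace_smul, h4]
    simp [mul_assoc]
  rw [h2, Complex.norm_real, Real.norm_of_nonneg (by positivity)] at h1
  have h3 : ((√r)⁻¹ * (√w)⁻¹ * w) ^ 2 ≤ M := le_trans (by gcongr) (hF _ hSsub)
  have h4 : ((√r)⁻¹ * (√w)⁻¹ * w) ^ 2 = w / r := by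
    rw [mul_pow, mul_pow, inv_pow, inv_pow, Real.sq_sqrt hr.le, Real.sq_sqrt hw0.le]
    field_simp
  rw [h4, div_le_iff₀ hr] at h3
  exact h3

end ChainRule

/-! ### The chain rule for purifications and for states -/

section ChainRule

lemma hsVec_mul_proj_norm_le {m n : Type*} [Fintype m] [Fintype n] {P : Matrix n n ℂ} (hP : Pᴴ = P)
    (hPP : P * P = P) (X : Matrix m n ℂ) : ‖hsVec (X * P)‖ ≤ ‖hsVec X‖ :=
  norm_le_of_inner_eq_zero (inner_hsVec_mul_proj hP hPP X X)

lemma vecDist_mul_proj_le {m n : Type*} [Fintype m] [Fintype n] {P : Matrix n n ℂ} (hP : Pᴴ = P)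
    (hPP : P * P = P) {X Y : Matrix m n ℂ} (hX : ‖hsVec X‖ ≤ 1) (hY : ‖hsVec Y‖ ≤ 1) :
    vecDist (hsVec (X * P)) (hsVec (Y * P)) ≤ vecDist (hsVec X) (hsVec Y) :=
  vecDist_proj_le hX hY (inner_hsVec_mul_proj hP hPP X X) (inner_hsVec_mul_proj hP hPP Y Y)
    (inner_hsVec_mul_proj hP hPP X Y) (inner_hsVec_mul_proj hP hPP Y X)

/-- The path is `Y P → X P → Z P → Z → X`. Projecting both endpoints does not increase distance, so
`d(Z, X)` is paid twice; this yields the coefficient 2 of `ε''`. -/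
lemma vecDist_mul_proj_self_le_add {m n : Type*} [Fintype m] [Fintype n] {P : Matrix n n ℂ}
    (hP : Pᴴ = P) (hPP : P * P = P) {X Y Z : Matrix m n ℂ} (hX : ‖hsVec X‖ ≤ 1)
    (hY : ‖hsVec Y‖ ≤ 1) (hZ : ‖hsVec Z‖ ≤ 1) :
    vecDist (hsVec (Y * P)) (hsVec X) ≤ vecDist (hsVec Y) (hsVec X)
      + 2 * vecDist (hsVec Z) (hsVec X) + vecDist (hsVec (Z * P)) (hsVec Z) := by
  have hXP := (hsVec_mul_proj_norm_le hP hPP X).trans hX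
  have hYP := (hsVec_mul_proj_norm_le hP hPP Y).trans hY
  have hZP := (hsVec_mul_proj_norm_le hP hPP Z).trans hZ
  have h1 := vecDist_triangle hYP hXP hX
  have h2 := vecDist_triangle hXP hZP hX
  have h3 := vecDist_triangle hZP hZ hX
  have h4 := vecDist_mul_proj_le hP hPP hY hX
  have h5 := vecDist_mul_proj_le hP hPP hX hZ
  rw [vecDist_comm (hsVec X)] at h5
  linarith

lemma one_sub_sqrt_pos {ε : ℝ} (hε : 0 < ε) : 0 < 1 - √(1 - ε ^ 2) := by
  rw [sub_pos, Real.sqrt_lt' one_pos]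
  nlinarith

lemma isSubState_mul_conjTranspose {m n : Type*} [Fintype m] [Fintype n] {X : Matrix m n ℂ}
    (hX : ‖hsVec X‖ ≤ 1) : IsSubState (X * Xᴴ) := by
  refine ⟨Matrix.posSemidef_self_mul_conjTranspose X, ?_⟩
  rw [← norm_hsVec_sq']
  nlinarith [norm_nonneg (hsVec X)]

variable {a b c d : Type*} [Fintype a] [DecidableEq a] [Fintype b] [DecidableEq b]
  [Fintype c] [DecidableEq c] [Fintype d] [DecidableEq d]

/-- The chain rule on the level of purifications: `R₁` and `R₂` are purifications close to `R`, the
first of large min-entropy `AB|C`, the second of small max-entropy `A|BC`. -/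
lemma exists_closeState_le {R R₁ R₂ : Matrix (a × b × c) d ℂ} (hR : IsSubState (R * Rᴴ))
    (hR₁ : IsSubState (R₁ * R₁ᴴ)) (hR₂ : IsSubState (R₂ * R₂ᴴ)) {ε ε₁ ε₂ : ℝ} (hε : 0 < ε)
    (h₁ : vecDist (hsVec R₁) (hsVec R) ≤ ε₁) (h₂ : vecDist (hsVec R₂) (hsVec R) ≤ ε₂)
    {σ : Matrix c c ℂ} (hσ : IsSubState σ) {r M : ℝ} (hr : 0 < r) (hM : 0 < M)
    (hmin : R₁ * R₁ᴴ ≤ r • ((1 : Matrix a a ℂ) ⊗ₖ ((1 : Matrix b b ℂ) ⊗ₖ σ)))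
    (hmax : ∀ τ : Matrix (b × c) (b × c) ℂ, IsSubState τ →
      fidelity (R₂ * R₂ᴴ) ((1 : Matrix a a ℂ) ⊗ₖ τ) ^ 2 ≤ M) :
    ∃ ξ ∈ closeStates (2 * ε + ε₁ + 2 * ε₂) (traceFst (R * Rᴴ)),
      ∃ ω : Matrix c c ℂ, IsSubState ω ∧
        ξ ≤ (M * r / (1 - √(1 - ε ^ 2)) ^ 2) • ((1 : Matrix b b ℂ) ⊗ₖ ω) := by
  have hδ := one_sub_sqrt_pos hε
  set δ := 1 - √(1 - ε ^ 2) with hδ_def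
  -- The threshold is chosen so that `E` carries weight at most `δ` of `R₂`, matching the loss
  -- caused by `P`.
  set s := M * r / δ ^ 2 with hs_def
  have hs : 0 < s := by positivity
  obtain ⟨P, hP, hPP, hPtr, hPd⟩ := exists_projection_of_le hσ hr hδ hmin
  set T := foldFst (foldFst R₁) with hT
  have hPpos : P.PosSemidef := by
    have := Matrix.posSemidef_conjTranspose_mul_self P
    rwa [hP, hPP] at this
  have hYpos : (traceFst P).PosSemidef := by
    have := traceFst_mono hPpos.nonneg
    rw [← Matrix.nonneg_iff_posSemidef]
    refine le_trans (le_of_eq ?_) this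
    ext; simp [traceFst]
  obtain ⟨E, hE, hEE, hE1, hE2⟩ := exists_spectral_projection hYpos hs.le
  have hYh : (1 - E)ᴴ = 1 - E := by
    rw [Matrix.conjTranspose_sub, Matrix.conjTranspose_one, hE]
  have hYY : (1 - E) * (1 - E) = 1 - E := by
    rw [Matrix.mul_sub, Matrix.mul_one, Matrix.sub_mul, Matrix.one_mul, hEE, sub_self, sub_zero]
  have hEtr : traceFst E ≤ (r / δ / s) • 1 := by
    have h1 := traceFst_mono hE1
    rw [traceFst_smul] at h1
    have h2 := smul_le_smul_real (inv_nonneg.2 hs.le) (h1.trans hPtr)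
    rwa [smul_smul, smul_smul, inv_mul_cancel₀ hs.ne', one_smul, inv_mul_eq_div] at h2
  have hw := norm_foldFst_mul_proj_sq_le hE hEE (by positivity) hM.le hEtr hmax
  have hMr : M * (r / δ / s) = δ := by
    rw [hs_def]; field_simp
  rw [hMr] at hw
  have hnR : ‖hsVec (foldFst R)‖ ≤ 1 := by
    rw [← norm_unfoldFst]; exact norm_hsVec_le_one hR
  have hnR₁ : ‖hsVec (foldFst R₁)‖ ≤ 1 := by
    rw [← norm_unfoldFst]; exact norm_hsVec_le_one hR₁
  have hnR₂ : ‖hsVec (foldFst R₂)‖ ≤ 1 := by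
    rw [← norm_unfoldFst]; exact norm_hsVec_le_one hR₂
  have hnT : ‖hsVec T‖ ≤ 1 := by
    rw [← norm_unfoldFst]; exact hnR₁
  have hnTP := (hsVec_mul_proj_norm_le hP hPP T).trans hnT
  have hnX : ‖hsVec (unfoldFst (T * P))‖ ≤ 1 := by rwa [norm_unfoldFst]
  have hd₁ : vecDist (hsVec (foldFst R₁)) (hsVec (foldFst R)) ≤ ε₁ := by
    rw [← vecDist_unfoldFst]; exact h₁
  have hd₂ : vecDist (hsVec (foldFst R₂)) (hsVec (foldFst R)) ≤ ε₂ := by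
    rw [← vecDist_unfoldFst]; exact h₂
  have hdT : vecDist (hsVec (unfoldFst (T * P))) (hsVec (foldFst R₁)) ≤ ε := by
    have h3 : vecDist (hsVec (unfoldFst (T * P))) (hsVec (unfoldFst T)) ≤ ε := by
      rw [vecDist_unfoldFst]
      exact vecDist_proj_self_le hε.le hnT (inner_hsVec_mul_proj hP hPP T T) hPd
    -- Unfolding undoes folding definitionally.
    exact h3
  have hdE : vecDist (hsVec (foldFst R₂ * (1 - E))) (hsVec (foldFst R₂)) ≤ ε := by
    refine vecDist_proj_self_le hε.le hnR₂ (inner_hsVec_mul_proj hYh hYY _ _) ?_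
    rwa [← hsVec_sub, Matrix.mul_sub, Matrix.mul_one, sub_sub_cancel]
  have hdist := vecDist_mul_proj_self_le_add hYh hYY hnR hnX hnR₂
  have htri := vecDist_triangle hnX hnR₁ hnR
  set X := unfoldFst (T * P) * (1 - E) with hX
  have hnXE : ‖hsVec X‖ ≤ 1 := (hsVec_mul_proj_norm_le hYh hYY _).trans hnX
  refine ⟨X * Xᴴ, ⟨isSubState_mul_conjTranspose hnXE, ?_⟩, T * P * (T * P)ᴴ,
    isSubState_mul_conjTranspose hnTP, ?_⟩
  · rw [traceFst_mul_conjTranspose]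
    refine (purifiedDist_le_vecDist _ _).trans ?_
    linarith
  · exact unfoldFst_proj_mul_le hP hPP hs (by rwa [hYh])

lemma vecDist_hsVec_submatrix {m n m' n' : Type*} [Fintype m] [Fintype n] [Fintype m'] [Fintype n']
    (f : m' ≃ m) (g : n' ≃ n) (X Y : Matrix m n ℂ) :
    vecDist (hsVec (X.submatrix f g)) (hsVec (Y.submatrix f g)) = vecDist (hsVec X) (hsVec Y) := by
  have h : ∀ Z W : Matrix m n ℂ, ((Z.submatrix f g)ᴴ * W.submatrix f g).trace = (Zᴴ * W).trace := by
    intro Z W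
    rw [Matrix.conjTranspose_submatrix, Matrix.submatrix_mul_equiv]
    simp only [Matrix.trace, Matrix.diag, Matrix.submatrix_apply]
    exact Equiv.sum_comp g fun i => (Zᴴ * W) i i
  simp only [vecDist, vecFidelity, inner_hsVec, norm_hsVec_sq, h]

/-- The chain rule for individual states near `ρ`. -/
lemma exists_closeState_traceFst_le {ρ ρ₂ : Matrix (a × b × c) (a × b × c) ℂ}
    {ρ₁ : Matrix ((a × b) × c) ((a × b) × c) ℂ} (hρ : IsSubState ρ) {ε ε₁ ε₂ : ℝ} (hε : 0 < ε)
    (h₁ : ρ₁ ∈ closeStates ε₁ (assocLeft ρ)) (h₂ : ρ₂ ∈ closeStates ε₂ ρ)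
    {σ : Matrix c c ℂ} (hσ : IsSubState σ) {r M : ℝ} (hr : 0 < r) (hM : 0 < M)
    (hmin : ρ₁ ≤ r • ((1 : Matrix (a × b) (a × b) ℂ) ⊗ₖ σ))
    (hmax : ∀ τ : Matrix (b × c) (b × c) ℂ, IsSubState τ →
      fidelity ρ₂ ((1 : Matrix a a ℂ) ⊗ₖ τ) ^ 2 ≤ M) :
    ∃ ξ ∈ closeStates (2 * ε + ε₁ + 2 * ε₂) (traceFst ρ),
      ∃ ω : Matrix c c ℂ, IsSubState ω ∧
        ξ ≤ (M * r / (1 - √(1 - ε ^ 2)) ^ 2) • ((1 : Matrix b b ℂ) ⊗ₖ ω) := by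
  set f := Equiv.prodAssoc a b c with hf
  set R := CFC.sqrt ρ with hR
  have hRR : R * Rᴴ = ρ := by rw [hR, conjTranspose_sqrt, sqrt_mul_sqrt hρ.1]
  obtain ⟨S, hS, hSt⟩ := exists_purification (R.submatrix f f) h₁.1.1
  obtain ⟨R₂, hR₂, hR₂t⟩ := exists_purification R h₂.1.1
  have hRf : R.submatrix f f * (R.submatrix f f)ᴴ = assocLeft ρ := by
    rw [Matrix.conjTranspose_submatrix, Matrix.submatrix_mul_equiv, hRR]
    rfl
  have hd₁ : vecDist (hsVec (S.submatrix f.symm f.symm)) (hsVec R) ≤ ε₁ := by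
    have h3 : R = (R.submatrix f f).submatrix f.symm f.symm := by simp
    rw [h3, vecDist_hsVec_submatrix, vecDist_eq_purifiedDist (by rw [hSt, hS]), hS, hRf]
    exact h₁.2
  have hd₂ : vecDist (hsVec R₂) (hsVec R) ≤ ε₂ := by
    rw [vecDist_eq_purifiedDist (by rw [hR₂t, hR₂]), hR₂, hRR]
    exact h₂.2
  have hS' : S.submatrix f.symm f.symm * (S.submatrix f.symm f.symm)ᴴ
      = ρ₁.submatrix f.symm f.symm := by
    rw [Matrix.conjTranspose_submatrix, Matrix.submatrix_mul_equiv, hS]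
  have hsub₁ : IsSubState (ρ₁.submatrix f.symm f.symm) := by
    refine ⟨h₁.1.1.submatrix _, le_trans (le_of_eq ?_) h₁.1.2⟩
    simp only [Matrix.trace, Matrix.diag, Matrix.submatrix_apply]
    rw [Equiv.sum_comp f.symm fun i => ρ₁ i i]
  have hmin' : ρ₁.submatrix f.symm f.symm
      ≤ r • ((1 : Matrix a a ℂ) ⊗ₖ ((1 : Matrix b b ℂ) ⊗ₖ σ)) := by
    have h4 := (Matrix.le_iff.1 hmin).submatrix f.symm
    rw [Matrix.le_iff]
    convert h4 using 1
    rw [← Matrix.one_kronecker_one, ← Matrix.kronecker_assoc']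
    rfl
  have h := exists_closeState_le (R := R) (R₁ := S.submatrix f.symm f.symm) (R₂ := R₂)
    (by rwa [hRR]) (by rwa [hS']) (by rw [hR₂]; exact h₂.1) hε hd₁ hd₂ hσ hr hM (by rwa [hS'])
    (by rwa [hR₂])
  rwa [hRR] at h

end ChainRule

/-! ### From operator inequalities to extended-real entropies -/

section Entropies

lemma elog2_le {x y : ℝ} (h : x ≤ y) : elog2 x ≤ ((Real.logb 2 y : ℝ) : EReal) := by
  unfold elog2
  split_ifs with hx
  · exact bot_le
  · exact EReal.coe_le_coe_iff.2 (Real.logb_le_logb_of_le one_lt_two (not_le.1 hx) h)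

lemma le_elog2 {x y : ℝ} (hy : 0 < y) (h : y ≤ x) : ((Real.logb 2 y : ℝ) : EReal) ≤ elog2 x := by
  rw [elog2, if_neg (not_le.2 (hy.trans_le h))]
  exact EReal.coe_le_coe_iff.2 (Real.logb_le_logb_of_le one_lt_two hy h)

lemma le_rpow_of_elog2_le {x μ : ℝ} (h : elog2 x ≤ (μ : EReal)) : x ≤ 2 ^ μ := by
  rcases le_or_gt x 0 with hx | hx
  · exact hx.trans (by positivity)
  · rw [elog2, if_neg (not_le.2 hx), EReal.coe_le_coe_iff] at h
    exact (Real.logb_le_iff_le_rpow one_lt_two hx).1 h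

lemma errorTerm_nonneg {ε : ℝ} (hε : 0 < ε) : 0 ≤ errorTerm ε := by
  have h1 := one_sub_sqrt_pos hε
  refine Real.logb_nonneg one_lt_two ?_
  rw [le_div_iff₀ h1]
  linarith [Real.sqrt_nonneg (1 - ε ^ 2)]

variable {a b c : Type*} [Fintype a] [DecidableEq a] [Fintype b] [DecidableEq b]
  [Fintype c] [DecidableEq c]

lemma fidelity_sq_le_of_hMax_le {ρ : Matrix (a × b) (a × b) ℂ} {μ : ℝ} (h : hMax ρ ≤ (μ : EReal))
    {τ : Matrix b b ℂ} (hτ : IsSubState τ) :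
    fidelity ρ ((1 : Matrix a a ℂ) ⊗ₖ τ) ^ 2 ≤ 2 ^ μ :=
  le_rpow_of_elog2_le ((le_iSup₂ (f := fun σ (_ : IsSubState σ) => hMaxRel ρ σ) τ hτ).trans h)

lemma le_smoothHMin {ρ ξ : Matrix (a × b) (a × b) ℂ} {ε l : ℝ} (hξ : ξ ∈ closeStates ε ρ)
    {ω : Matrix b b ℂ} (hω : IsSubState ω) (h : ξ ≤ ((2 : ℝ) ^ (-l)) • ((1 : Matrix a a ℂ) ⊗ₖ ω)) :
    (l : EReal) ≤ smoothHMin ε ρ := by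
  refine le_trans ?_ (le_iSup₂ (f := fun ρ' (_ : ρ' ∈ closeStates ε ρ) => hMin ρ') ξ hξ)
  refine le_trans ?_ (le_iSup₂ (f := fun σ (_ : IsSubState σ) => hMinRel ξ σ) ω hω)
  exact le_iSup₂ (f := fun (l : ℝ) (_ : ξ ≤ ((2 : ℝ) ^ (-l)) • ((1 : Matrix a a ℂ) ⊗ₖ ω)) =>
    (l : EReal)) l h

lemma hMax_lt_top {ρ : Matrix (a × b) (a × b) ℂ} (hρ : IsSubState ρ) : hMax ρ < ⊤ := by
  refine lt_of_le_of_lt ?_ (EReal.coe_lt_top (Real.logb 2 (Fintype.card a + 1)))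
  refine iSup₂_le fun τ hτ => elog2_le ?_
  have hτ0 := (Complex.le_def.1 hτ.1.trace_nonneg).1
  have hρ0 := (Complex.le_def.1 hρ.1.trace_nonneg).1
  have h1 := fidelity_le hρ.1 (Matrix.PosSemidef.one.kronecker hτ.1 :
    ((1 : Matrix a a ℂ) ⊗ₖ τ).PosSemidef)
  have h2 : ((1 : Matrix a a ℂ) ⊗ₖ τ).trace.re = Fintype.card a * τ.trace.re := by
    simp [Matrix.trace_kronecker]
  have h3 : fidelity ρ ((1 : Matrix a a ℂ) ⊗ₖ τ) ^ 2
      ≤ (√ρ.trace.re * √((1 : Matrix a a ℂ) ⊗ₖ τ).trace.re) ^ 2 := by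
    have := fidelity_nonneg ρ ((1 : Matrix a a ℂ) ⊗ₖ τ)
    gcongr
  simp only [Complex.zero_re] at hτ0 hρ0
  rw [mul_pow, Real.sq_sqrt hρ0, h2, Real.sq_sqrt (by positivity)] at h3
  have h4 : (Fintype.card a : ℝ) * τ.trace.re ≤ Fintype.card a :=
    mul_le_of_le_one_right (by positivity) hτ.2
  have h5 : ρ.trace.re * (Fintype.card a * τ.trace.re) ≤ Fintype.card a * τ.trace.re :=
    mul_le_of_le_one_left (by positivity) hρ.2
  linarith

/-- Uhlmann's bound applies to the purifications `√ρ` and a multiple of the identity, with `√ρ`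
itself as the contraction, which is allowed because `ρ ≤ 1`. -/
lemma trace_sq_div_le_fidelity_sq {ρ : Matrix (a × b) (a × b) ℂ} (hρ : IsSubState ρ) [Nonempty b] :
    ρ.trace.re ^ 2 / Fintype.card b ≤
      fidelity ρ ((1 : Matrix a a ℂ) ⊗ₖ ((Fintype.card b : ℝ)⁻¹ • (1 : Matrix b b ℂ))) ^ 2 := by
  set D : ℝ := (Fintype.card b : ℝ) with hD
  have hD0 : 0 < D := by rw [hD]; exact_mod_cast Fintype.card_pos
  set Q := CFC.sqrt ρ
  have hQh : Qᴴ = Q := conjTranspose_sqrt ρ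
  have hQQ : Q * Q = ρ := sqrt_mul_sqrt hρ.1
  have hQ1 : Qᴴ * Q ≤ 1 := by
    rw [hQh, hQQ]
    refine (le_trace_smul_one hρ.1).trans ?_
    rw [Matrix.le_iff]
    have := (Matrix.PosSemidef.one (n := a × b) (R := ℂ)).smul (sub_nonneg.2 hρ.2)
    rwa [sub_smul, one_smul] at this
  have h := norm_trace_le_fidelity Q ((√D)⁻¹ • (1 : Matrix (a × b) (a × b) ℂ)) hQ1
  have h1 : (√D)⁻¹ • (1 : Matrix (a × b) (a × b) ℂ) * ((√D)⁻¹ • 1)ᴴ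
      = (1 : Matrix a a ℂ) ⊗ₖ (D⁻¹ • (1 : Matrix b b ℂ)) := by
    rw [Matrix.conjTranspose_smul, star_trivial, Matrix.smul_mul, Matrix.mul_smul, smul_smul,
      ← mul_inv, Real.mul_self_sqrt hD0.le, Matrix.kronecker_smul, Matrix.one_kronecker_one]
    simp
  have h2 : ‖(Qᴴ * ((√D)⁻¹ • (1 : Matrix (a × b) (a × b) ℂ)) * Q).trace‖
      = (√D)⁻¹ * ‖ρ.trace‖ := by
    rw [Matrix.mul_smul, Matrix.mul_one, Matrix.smul_mul, hQh, hQQ, Matrix.trace_smul, norm_smul,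
      Real.norm_of_nonneg (by positivity)]
  rw [h1, h2, hQh, hQQ] at h
  calc ρ.trace.re ^ 2 / D ≤ ‖ρ.trace‖ ^ 2 / D := by
        have : ρ.trace.re ^ 2 ≤ ‖ρ.trace‖ ^ 2 := sq_le_sq'
          (neg_le_of_abs_le (Complex.abs_re_le_norm _)) (Complex.re_le_norm _)
        gcongr
    _ = ((√D)⁻¹ * ‖ρ.trace‖) ^ 2 := by
        rw [mul_pow, inv_pow, Real.sq_sqrt hD0.le]; field_simp
    _ ≤ _ := by gcongr

/-- States near a state of sufficiently large trace have trace bounded away from zero. -/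
lemma sqrt_trace_lower_bound {n : Type*} [Fintype n] [DecidableEq n] {ρ ρ' : Matrix n n ℂ}
    (hρ : IsSubState ρ) {ε : ℝ} (h : ρ' ∈ closeStates ε ρ) :
    √(1 - ε ^ 2) - √(1 - ρ.trace.re) ≤ √ρ'.trace.re := by
  have hρ0 := (Complex.le_def.1 hρ.1.trace_nonneg).1
  have hρ'0 := (Complex.le_def.1 h.1.1.trace_nonneg).1
  simp only [Complex.zero_re] at hρ0 hρ'0
  have h1 := (Real.sqrt_le_iff.1 h.2).2
  have h2 : √(1 - ε ^ 2) ≤ genFidelity ρ' ρ :=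
    Real.sqrt_le_iff.2 ⟨add_nonneg (fidelity_nonneg _ _) (Real.sqrt_nonneg _), by linarith⟩
  have h3 : fidelity ρ' ρ ≤ √ρ'.trace.re :=
    (fidelity_le h.1.1 hρ.1).trans
      (mul_le_of_le_one_right (Real.sqrt_nonneg _) (Real.sqrt_le_one.2 hρ.2))
  have h4 : √((1 - ρ'.trace.re) * (1 - ρ.trace.re)) ≤ √(1 - ρ.trace.re) :=
    Real.sqrt_le_sqrt (mul_le_of_le_one_left (sub_nonneg.2 hρ.2) (by linarith))
  unfold genFidelity at h2
  linarith

/-- States in the ball have trace at least `η²` with `η > 0`, so testing with the maximally mixed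
state bounds their max-entropies below uniformly. -/
lemma bot_lt_smoothHMax {ρ : Matrix (a × b) (a × b) ℂ} (hρ : IsSubState ρ) {ε : ℝ}
    (h : ε ^ 2 < ρ.trace.re) : ⊥ < smoothHMax ε ρ := by
  have hne : Nonempty b := by
    by_contra hb
    rw [not_nonempty_iff] at hb
    have : ρ.trace = 0 := by simp [Matrix.trace]
    rw [this] at h
    simp only [Complex.zero_re] at h
    nlinarith
  have hD0 : (0 : ℝ) < Fintype.card b := by exact_mod_cast Fintype.card_pos
  set η := √(1 - ε ^ 2) - √(1 - ρ.trace.re) with hη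
  have hη0 : 0 < η := sub_pos.2 (Real.sqrt_lt_sqrt (sub_nonneg.2 hρ.2) (by linarith))
  have hτ : IsSubState ((Fintype.card b : ℝ)⁻¹ • (1 : Matrix b b ℂ)) := by
    refine ⟨Matrix.PosSemidef.one.smul (by positivity), le_of_eq ?_⟩
    rw [Matrix.trace_smul, Matrix.trace_one, Complex.smul_re, Complex.natCast_re, smul_eq_mul,
      inv_mul_cancel₀ hD0.ne']
  refine lt_of_lt_of_le (EReal.bot_lt_coe (Real.logb 2 ((η ^ 2) ^ 2 / Fintype.card b))) ?_
  refine le_iInf₂ fun ρ' hρ' => ?_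
  refine le_trans ?_ (le_iSup₂ (f := fun σ (_ : IsSubState σ) => hMaxRel ρ' σ) _ hτ)
  refine le_elog2 (by positivity) (le_trans ?_ (trace_sq_div_le_fidelity_sq hρ'.1))
  have h1 := sqrt_trace_lower_bound hρ hρ'
  have h2 : η ^ 2 ≤ ρ'.trace.re := by
    have h3 : η ^ 2 ≤ √ρ'.trace.re ^ 2 := by gcongr
    rwa [Real.sq_sqrt (Complex.le_def.1 hρ'.1.1.trace_nonneg).1] at h3
  gcongr

lemma le_smoothHMin_traceFst {ρ ρ₂ : Matrix (a × b × c) (a × b × c) ℂ}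
    {ρ₁ : Matrix ((a × b) × c) ((a × b) × c) ℂ} (hρ : IsSubState ρ) {ε ε₁ ε₂ : ℝ} (hε : 0 < ε)
    (h₁ : ρ₁ ∈ closeStates ε₁ (assocLeft ρ)) (h₂ : ρ₂ ∈ closeStates ε₂ ρ)
    {σ : Matrix c c ℂ} (hσ : IsSubState σ) {l μ : ℝ}
    (hmin : ρ₁ ≤ ((2 : ℝ) ^ (-l)) • ((1 : Matrix (a × b) (a × b) ℂ) ⊗ₖ σ))
    (hmax : hMax ρ₂ ≤ (μ : EReal)) :
    ((l - μ - 2 * errorTerm ε : ℝ) : EReal)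
      ≤ smoothHMin (2 * ε + ε₁ + 2 * ε₂) (traceFst ρ) := by
  obtain ⟨ξ, hξ, ω, hω, hle⟩ := exists_closeState_traceFst_le hρ hε h₁ h₂ hσ
    (Real.rpow_pos_of_pos two_pos (-l)) (Real.rpow_pos_of_pos two_pos μ) hmin
    fun τ hτ => fidelity_sq_le_of_hMax_le hmax hτ
  refine le_smoothHMin hξ hω (hle.trans (le_of_eq ?_))
  have h1 := one_sub_sqrt_pos hε
  have h2 : (2 : ℝ) ^ errorTerm ε = 1 / (1 - √(1 - ε ^ 2)) :=
    Real.rpow_logb two_pos (by norm_num) (by positivity)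
  congr 1
  rw [show -(l - μ - 2 * errorTerm ε) = μ + -l + errorTerm ε + errorTerm ε by ring,
    Real.rpow_add two_pos, Real.rpow_add two_pos, Real.rpow_add two_pos, h2]
  field_simp

end Entropies

end SmoothEntropy

end

theorem mainTheorem3 {a b c : Type*} [Fintype a] [DecidableEq a] [Fintype b] [DecidableEq b]
    [Fintype c] [DecidableEq c]
    (ρ : Matrix (a × b × c) (a × b × c) ℂ) (hρ : SmoothEntropy.IsSubState ρ)
    (ε ε' ε'' : ℝ) (hε : 0 < ε) (hε' : 0 ≤ ε') (hε'' : 0 ≤ ε'')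
    (hρε'' : ε'' ^ 2 < ρ.trace.re) :
    SmoothEntropy.smoothHMin ε' (SmoothEntropy.assocLeft ρ) ≤
      SmoothEntropy.smoothHMax ε'' ρ
        + SmoothEntropy.smoothHMin (2 * ε + ε' + 2 * ε'') (SmoothEntropy.traceFst ρ)
        + ((3 * SmoothEntropy.errorTerm ε : ℝ) : EReal) := by
  refine iSup₂_le fun ρ₁ h₁ => iSup₂_le fun σ hσ => iSup₂_le fun l hl => ?_
  have hbot := SmoothEntropy.bot_lt_smoothHMax hρ hρε''
  have hf := SmoothEntropy.errorTerm_nonneg hε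
  have key := fun (ρ₂ : Matrix (a × b × c) (a × b × c) ℂ)
    (h₂ : ρ₂ ∈ SmoothEntropy.closeStates ε'' ρ) (μ : ℝ)
    (hμ : SmoothEntropy.hMax ρ₂ ≤ (μ : EReal)) =>
    SmoothEntropy.le_smoothHMin_traceFst hρ hε h₁ h₂ hσ hl hμ
  induction hH : SmoothEntropy.smoothHMin (2 * ε + ε' + 2 * ε'') (SmoothEntropy.traceFst ρ) with
  | top =>
    -- The hypothesis on `ε''` is needed here: `⊥ + ⊤ = ⊥` in `EReal`.
    rw [EReal.add_top_of_ne_bot hbot.ne', EReal.top_add_coe]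
    exact le_top
  | bot =>
    -- This case is impossible: `ρ` itself, whose max-entropy is below `⊤`, already yields a real
    -- lower bound.
    obtain ⟨μ, hμ, -⟩ := EReal.lt_iff_exists_real_btwn.1 (SmoothEntropy.hMax_lt_top hρ)
    have := key ρ (SmoothEntropy.mem_closeStates_self hρ hε'') μ hμ.le
    rw [hH] at this
    exact absurd this (not_le.2 (EReal.bot_lt_coe _))
  | coe h =>
    have hI : ((l - h - 3 * SmoothEntropy.errorTerm ε : ℝ) : EReal)
        ≤ SmoothEntropy.smoothHMax ε'' ρ := by
      refine le_iInf₂ fun ρ₂ h₂ => ?_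
      by_contra hlt
      obtain ⟨μ, hμ, hμ'⟩ := EReal.lt_iff_exists_real_btwn.1 (not_le.1 hlt)
      have := key ρ₂ h₂ μ hμ.le
      rw [hH, EReal.coe_le_coe_iff] at this
      rw [EReal.coe_lt_coe_iff] at hμ'
      -- `key` loses only two error terms; `hf` absorbs the third.
      linarith
    calc (l : EReal) = ((l - h - 3 * SmoothEntropy.errorTerm ε : ℝ) : EReal) + (h : EReal)
          + ((3 * SmoothEntropy.errorTerm ε : ℝ) : EReal) := by
          rw [← EReal.coe_add, ← EReal.coe_add]
          congr 1
          ring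
      _ ≤ _ := by gcongr
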